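/- Let $k \ge 0$ and let $\mathbb{P}_\Sigma$ be the complete simplicial toric variety of dimension $2k+1$ over $\mathbb{C}$ of a complete simplicial fan $\Sigma$. Let $\eta \in \operatorname{Pic}(\mathbb{P}_\Sigma)$ be an ample class (so $\mathbb{P}_\Sigma$ is projective), and for a closed $d$-dimensional subvariety $Z$ of $\mathbb{P}_\Sigma$ put $\deg_\eta Z = [Z]\cdot \eta^d$. Let $X \subset \mathbb{P}_\Sigma$ be an ample Cartier hypersurface, that is, the zero scheme of a nonzero section of an ample line bundle, whose class $\beta \in \operatorname{Pic}(\mathbb{P}_\Sigma)$ satisfies $$\beta = q\,\eta + \beta' \quad\text{in } \operatorname{Pic}(\mathbb{P}_\Sigma)\otimes\mathbb{Q},$$ where $q \in \mathbb{Q}_{>0}$ and $\beta' \in \operatorname{Pic}(\mathbb{P}_\Sigma)$ is nef. Let $V \subset X$ be a closed $k$-dimensional subvariety which is a complete intersection in $X$, in the sense that $V = X \cap W$ scheme-theoretically for some closed $(k+1)$-dimensional subvariety $W$ of $\mathbb{P}_\Sigma$. Then $\deg_\eta V \ge q$. (Here subvarieties are reduced, but not necessarily irreducible.) -/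

import Mathlib

open scoped TensorProduct

/-- A complete simplicial fan in the lattice `N = ℤⁿ`, with rays indexed by the finite type `ι`.
The cone spanned by the rays in `σ` belongs to the fan iff `σ ∈ cones`. -/
structure SimplicialFan (n : ℕ) (ι : Type*) [Fintype ι] [DecidableEq ι] where
  /-- the minimal generator of each ray -/
  gen : ι → Fin n → ℤ
  /-- the sets of rays that span a cone of the fan -/
  cones : Set (Finset ι)
  /-- ray generators are primitive lattice vectors (in particular nonzero) -/
  primitive : ∀ (ρ : ι) (c : ℤ) (w : Fin n → ℤ), gen ρ = c • w → IsUnit c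
  /-- each `ρ` really is a ray of the fan -/
  ray_mem : ∀ ρ, {ρ} ∈ cones
  /-- faces of cones of the fan belong to the fan -/
  face_mem : ∀ σ ∈ cones, ∀ τ ⊆ σ, τ ∈ cones
  /-- every cone is simplicial -/
  simplicial : ∀ σ ∈ cones, LinearIndependent ℤ (fun ρ : σ => gen ρ)
  /-- two cones meet along their common face -/
  inter : ∀ σ ∈ cones, ∀ τ ∈ cones, ∀ x : Fin n → ℝ,
    x ∈ PointedCone.hull ℝ ((fun (ρ : ι) (i : Fin n) => (gen ρ i : ℝ)) '' (σ : Set ι)) →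
    x ∈ PointedCone.hull ℝ ((fun (ρ : ι) (i : Fin n) => (gen ρ i : ℝ)) '' (τ : Set ι)) →
    x ∈ PointedCone.hull ℝ ((fun (ρ : ι) (i : Fin n) => (gen ρ i : ℝ)) '' ((σ ∩ τ : Finset ι) : Set ι))
  /-- the cones cover `N ⊗ ℝ` -/
  complete : ∀ x : Fin n → ℝ, ∃ σ ∈ cones,
    x ∈ PointedCone.hull ℝ ((fun (ρ : ι) (i : Fin n) => (gen ρ i : ℝ)) '' (σ : Set ι))

namespace SimplicialFan

noncomputable section

variable {n : ℕ} {ι : Type*} [Fintype ι] [DecidableEq ι] (Φ : SimplicialFan n ι)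

/-! ### The class group and the Cox ring -/

/-- The pairing `⟨m, v_ρ⟩` of a character `m ∈ M = ℤⁿ` with all ray generators; this is the
divisor of the character `χ^m`, as a torus-invariant Weil divisor `∑ ⟨m, v_ρ⟩ D_ρ`. -/
def divChar : (Fin n → ℤ) →ₗ[ℤ] (ι → ℤ) where
  toFun m ρ := m ⬝ᵥ Φ.gen ρ
  map_add' m m' := by ext ρ; simp [add_dotProduct]
  map_smul' c m := by ext ρ; simpa using smul_dotProduct c m (Φ.gen ρ)

/-- The divisor class group `Cl(P_Σ) = ℤ^{Σ(1)} / M`. -/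
abbrev Cl : Type _ := (ι → ℤ) ⧸ LinearMap.range Φ.divChar

/-- The class of the torus-invariant Weil divisor `∑ a_ρ D_ρ`. -/
def cls (a : ι → ℤ) : Φ.Cl := Submodule.Quotient.mk a

/-- `α ∈ Pic(P_Σ) ⊆ Cl(P_Σ)`: the class `α` is represented by a divisor `∑ a_ρ D_ρ` which on each
affine chart `U_σ` is the divisor of a character. -/
def IsCartier (α : Φ.Cl) : Prop :=
  ∃ a : ι → ℤ, Φ.cls a = α ∧ ∀ σ ∈ Φ.cones, ∃ m : Fin n → ℤ, ∀ ρ ∈ σ, m ⬝ᵥ Φ.gen ρ = a ρ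

/-- The graded piece `S^α = H⁰(P_Σ, O(α))` of the Cox ring `S = ℂ[x_ρ]`, where `x_ρ` has degree
`[D_ρ] ∈ Cl(P_Σ)`. -/
def S (α : Φ.Cl) : Submodule ℂ (MvPolynomial ι ℂ) :=
  MvPolynomial.weightedHomogeneousSubmodule ℂ (fun ρ => Φ.cls (Pi.single ρ 1)) α

/-- The monomial `x^σ̂ = ∏_{ρ ∉ σ} x_ρ`. -/
def xHat (σ : Finset ι) : MvPolynomial ι ℂ := ∏ ρ ∈ σᶜ, MvPolynomial.X ρ

/-- The degree of `x^σ̂`, that is, the class of `∑_{ρ ∉ σ} D_ρ`. -/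
def degHat (σ : Finset ι) : Φ.Cl := ∑ ρ ∈ σᶜ, Φ.cls (Pi.single ρ 1)

/-! ### The toric variety `P_Σ = (ℂ^{Σ(1)} ∖ V(B)) / G` -/

/-- `ℂ^{Σ(1)} ∖ V(B)`: the points at which some `x^σ̂`, `σ ∈ Σ`, does not vanish. -/
structure CoxSpace where
  /-- the homogeneous coordinates -/
  coord : ι → ℂ
  /-- the coordinates do not lie in the zero locus of the irrelevant ideal -/
  mem : ∃ σ ∈ Φ.cones, ∀ ρ ∉ σ, coord ρ ≠ 0

/-- The Zariski topology on `ℂ^{Σ(1)} ∖ V(B)`. -/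
instance : TopologicalSpace Φ.CoxSpace :=
  TopologicalSpace.induced
    (fun x => (MvPolynomial.pointToPoint x.coord : PrimeSpectrum (MvPolynomial ι ℂ))) inferInstance

/-- The group `G = Hom(Cl(P_Σ), ℂˣ)`, as a subgroup of the torus `(ℂˣ)^{Σ(1)}`. -/
def G : Subgroup (ι → ℂˣ) where
  carrier := {t | ∀ m : Fin n → ℤ, ∏ ρ, t ρ ^ (m ⬝ᵥ Φ.gen ρ) = 1}
  one_mem' m := by simp
  mul_mem' {s t} hs ht m := by
    simp only [Set.mem_ofPred_eq] at hs ht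
    simp [mul_zpow, Finset.prod_mul_distrib, hs m, ht m]
  inv_mem' {t} ht m := by
    simp only [Set.mem_ofPred_eq] at ht
    simp [ht m]

/-- Two points of `ℂ^{Σ(1)} ∖ V(B)` are equivalent if they lie in the same `G`-orbit. -/
instance orbitSetoid : Setoid Φ.CoxSpace where
  r x y := ∃ t ∈ Φ.G, ∀ ρ, y.coord ρ = (t ρ : ℂ) * x.coord ρ
  iseqv :=
    { refl := fun _ => ⟨1, Φ.G.one_mem, fun _ => by simp⟩
      symm := fun {x y} ⟨t, ht, h⟩ => ⟨t⁻¹, Φ.G.inv_mem ht, fun ρ => by simp [h ρ]⟩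
      trans := fun {x y z} ⟨s, hs, h⟩ ⟨t, ht, h'⟩ =>
        ⟨t * s, Φ.G.mul_mem ht hs, fun ρ => by simp [h ρ, h' ρ, mul_assoc]⟩ }

/-- The complete simplicial toric variety `P_Σ` over `ℂ` (its closed points), with its Zariski
topology, as the quotient of `ℂ^{Σ(1)} ∖ V(B)` by `G`. -/
def Variety : Type _ := Quotient Φ.orbitSetoid

instance : TopologicalSpace Φ.Variety :=
  inferInstanceAs (TopologicalSpace (Quotient Φ.orbitSetoid))

/-- The point of `P_Σ` with given homogeneous coordinates. -/
def point (x : Φ.CoxSpace) : Φ.Variety := Quotient.mk Φ.orbitSetoid x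

/-- The open set of points of `P_Σ` at which the homogeneous polynomial `s` does not vanish. -/
def nonvanishing (s : MvPolynomial ι ℂ) : Set Φ.Variety :=
  Φ.point '' {x | MvPolynomial.eval x.coord s ≠ 0}

/-- The homogeneous ideal `I(Z)` of all polynomials that vanish on `Z ⊆ P_Σ`. -/
def ideal (Z : Set Φ.Variety) : Ideal (MvPolynomial ι ℂ) :=
  MvPolynomial.vanishingIdeal ℂ (CoxSpace.coord '' (Φ.point ⁻¹' Z))

/-- Two homogeneous ideals `I`, `J` of the Cox ring define the same closed subscheme of `P_Σ`:
on each affine chart `U_σ`, with coordinate ring `ℂ[U_σ] = (S_{x^σ̂})_0`, the ideals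
`(I_{x^σ̂})_0` and `(J_{x^σ̂})_0` agree. Elements of `ℂ[U_σ]` are the fractions `g / (x^σ̂)^N`
with `deg g = N deg x^σ̂`. -/
def SameSubscheme (I J : Ideal (MvPolynomial ι ℂ)) : Prop :=
  ∀ σ ∈ Φ.cones, ∀ N : ℕ, ∀ g ∈ Φ.S (N • Φ.degHat σ),
    (∃ M : ℕ, xHat σ ^ M * g ∈ I) ↔ (∃ M : ℕ, xHat σ ^ M * g ∈ J)

/-- `V` is the scheme-theoretic intersection in `P_Σ` of the hypersurface `f = 0` and the closed
subset `W`, where `V` and `W` carry their reduced structures. -/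
def IsSchemeInter (f : MvPolynomial ι ℂ) (W V : Set Φ.Variety) : Prop :=
  Φ.SameSubscheme (Φ.ideal V) (Φ.ideal W ⊔ Ideal.span {f})

/-! ### Ampleness, degrees, nefness -/

/-- The class `α` is Cartier and ample: the open sets of points where a section of some `O(mα)`,
`m ≥ 1`, does not vanish form a base of the Zariski topology. -/
def IsAmple (α : Φ.Cl) : Prop :=
  Φ.IsCartier α ∧ ∀ (U : Set Φ.Variety), IsOpen U → ∀ p ∈ U,
    ∃ m : ℕ, 1 ≤ m ∧ ∃ s ∈ Φ.S (m • α), p ∈ Φ.nonvanishing s ∧ Φ.nonvanishing s ⊆ U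

/-- The Hilbert function of `Z ⊆ P_Σ`: the dimension of the degree `α` part of the homogeneous
coordinate ring `S / I(Z)`. -/
def hilbertFunction (Z : Set Φ.Variety) (α : Φ.Cl) : ℕ :=
  Module.finrank ℂ
    ((Φ.S α).map (Ideal.Quotient.mkₐ ℂ (Φ.ideal Z)).toLinearMap)

open Classical in
/-- The Hilbert polynomial of `Z` with respect to the (ample) class `η`: the polynomial `P` with
`P(m) = dim (S / I(Z))^{mη}` for all large `m`. -/
def hilbertPoly (η : Φ.Cl) (Z : Set Φ.Variety) : Polynomial ℚ :=
  if h : ∃ P : Polynomial ℚ, ∀ᶠ m : ℕ in Filter.atTop,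
      P.eval (m : ℚ) = Φ.hilbertFunction Z (m • η)
  then h.choose else 0

/-- The degree `deg_η Z = [Z] · η^d` of a closed `d`-dimensional `Z ⊆ P_Σ` with respect to the
ample class `η`: `d!` times the coefficient of `m^d` in the Hilbert polynomial of `Z`. -/
def degree (d : ℕ) (η : Φ.Cl) (Z : Set Φ.Variety) : ℚ :=
  (d.factorial : ℚ) * (Φ.hilbertPoly η Z).coeff d

/-- The class `α` is Cartier and nef: `α · C ≥ 0` for all irreducible closed curves `C`. Here
`α · C` is computed by linearity as `(α + A) · C - A · C` with `A` and `α + A` ample. -/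
def IsNef (α : Φ.Cl) : Prop :=
  Φ.IsCartier α ∧ ∀ C : Set Φ.Variety, IsClosed C → IsIrreducible C → topologicalKrullDim C = 1 →
    ∀ A : Φ.Cl, Φ.IsAmple A → Φ.IsAmple (α + A) →
      0 ≤ Φ.degree 1 (α + A) C - Φ.degree 1 A C

end

end SimplicialFan

/-! Everything is read off from Hilbert functions `hilb J` of homogeneous ideals J of the Cox ring
S. If V(J) has dimension at most k, then dim (S/J)^{mη+α} agrees for large m with a polynomial of
degree at most k whose coefficient of m^k does not depend on the Cartier class α
(`IsAmple.exists_isEvPoly`).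

Let J = I(W) and K = (J : f), which discards the components of W inside X. Since J is radical, f is
a nonzerodivisor modulo K, so K + (f) has Hilbert function h_K(mη) − h_K(mη − β). Let e be its
coefficient of m^k and c the coefficient of m^{k+1} in h_K. Clearing denominators, Nβ = pη + Nβ'
with q = p/N. Descending from mη to mη − Nβ in N steps of β costs Ne at order m^k. Descending by N
steps of β' and then by pη costs a nonnegative amount, by nefness (`IsNef.coeff_nonneg`), plus
(k+1)pc. Hence e ≥ (k+1)qc (`le_coeff_of_nsmul_eq`).

The equality of schemes V = X ∩ W puts I(V) inside J + (f) in large degrees mη, so k!·e ≤ deg V.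
Finally (k+1)!·c is an integer (`IsEvPoly.exists_int`), and it is positive because V(K) still has
dimension k+1 (`IsAmple.coeff_pos`). Thus deg V ≥ q(k+1)!c ≥ q.

Statements about general J are proved by `devissage`, down to ideals with irreducible zero locus,
which are cut by sections. The toric input is a combinatorial substitute for Serre's theorems:
`IsAmple.eventually_exists_mdeg_eq` supplies sections, and `IsAmple.eventually_forall_mdeg` makes
local membership in an ideal global in large degree. -/

open Filter TopologicalSpace

/-! ### Krull dimension of closed subsets -/

section KrullDim

variable {X : Type*} [TopologicalSpace X]

theorem Topology.IsInducing.isIrreducible_of_image {Y : Type*} [TopologicalSpace Y] {f : Y → X}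
    (hf : Topology.IsInducing f) {A : Set Y} (hA : IsIrreducible (f '' A)) : IsIrreducible A := by
  refine ⟨Set.image_nonempty.mp hA.1, ?_⟩
  rintro u v hu hv ⟨x, hx, hxu⟩ ⟨y, hy, hyv⟩
  obtain ⟨u', hu', rfl⟩ := hf.isOpen_iff.mp hu
  obtain ⟨v', hv', rfl⟩ := hf.isOpen_iff.mp hv
  obtain ⟨_, ⟨z, hz, rfl⟩, h1, h2⟩ :=
    hA.2 u' v' hu' hv' ⟨f x, ⟨x, hx, rfl⟩, hxu⟩ ⟨f y, ⟨y, hy, rfl⟩, hyv⟩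
  exact ⟨z, hz, h1, h2⟩

/-- For closed `Z`, chains in the subspace and chains in the ambient space lying in `Z` correspond
by taking traces and closures. Dimensions of different subsets can then be compared inside one
poset. -/
theorem topologicalKrullDim_le_iff_length_le {Z : Set X} (hZ : IsClosed Z) (n : ℕ) :
    topologicalKrullDim Z ≤ n ↔
      ∀ c : LTSeries (IrreducibleCloseds X), (c.last : Set X) ⊆ Z → c.length ≤ n := by
  constructor
  · intro h c hc
    have hsub : ∀ i, (c i : Set X) ⊆ Z := fun i =>
      (show (c i : Set X) ⊆ c.last from c.monotone (Fin.le_last i)).trans hc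
    have hpre : ∀ i, Subtype.val '' (Subtype.val ⁻¹' (c i : Set X) : Set Z) = (c i : Set X) :=
      fun i => by rw [Subtype.image_preimage_coe, Set.inter_eq_right]; exact hsub i
    let e : Fin (c.length + 1) → IrreducibleCloseds Z := fun i =>
      ⟨Subtype.val ⁻¹' (c i : Set X), by
        have h1 := (c i).isIrreducible
        rw [← hpre i] at h1
        exact Topology.IsInducing.subtypeVal.isIrreducible_of_image h1,
        (c i).isClosed.preimage continuous_subtype_val⟩
    have he : StrictMono e := by
      intro i j hij
      have h1 : (c i : Set X) ⊂ c j := c.strictMono hij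
      refine lt_of_le_of_ne (show (Subtype.val ⁻¹' (c i : Set X) : Set Z) ⊆ Subtype.val ⁻¹' (c j : Set X)
        from Set.preimage_mono h1.1) fun heq => h1.ne ?_
      have h2 : ((e i : IrreducibleCloseds Z) : Set Z) = e j := by rw [heq]
      rw [← hpre i, ← hpre j]
      exact congrArg _ h2
    let s : LTSeries (IrreducibleCloseds Z) := LTSeries.mk c.length e he
    have h3 : ((s.length : ℕ∞) : WithBot ℕ∞) ≤ topologicalKrullDim Z := by
      exact_mod_cast Order.LTSeries.length_le_krullDim s
    have h4 := h3.trans h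
    exact_mod_cast h4
  · intro h
    refine iSup_le fun s => ?_
    have h1 := h (s.map _ (IrreducibleCloseds.map_strictMono_of_isInducing
      (Topology.IsInducing.subtypeVal (t := Z)))) ?_
    · exact_mod_cast h1
    · rw [LTSeries.last_map]
      refine closure_minimal ?_ hZ
      rintro _ ⟨x, -, rfl⟩
      exact x.2

theorem topologicalKrullDim_mono {Z Y : Set X} (h : Z ⊆ Y) :
    topologicalKrullDim Z ≤ topologicalKrullDim Y :=
  (Topology.IsEmbedding.inclusion h).isInducing.topologicalKrullDim_le

theorem topologicalKrullDim_union_le {Z Y : Set X} (hZ : IsClosed Z) (hY : IsClosed Y) {n : ℕ}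
    (h1 : topologicalKrullDim Z ≤ n) (h2 : topologicalKrullDim Y ≤ n) :
    topologicalKrullDim (Z ∪ Y : Set X) ≤ n := by
  rw [topologicalKrullDim_le_iff_length_le (hZ.union hY)]
  rw [topologicalKrullDim_le_iff_length_le hZ] at h1
  rw [topologicalKrullDim_le_iff_length_le hY] at h2
  intro c hc
  rcases isPreirreducible_iff_isClosed_union_isClosed.mp c.last.isIrreducible.2 Z Y hZ hY hc with h | h
  · exact h1 c h
  · exact h2 c h

theorem topologicalKrullDim_le_of_ssubset {Z Y : Set X} (hZ : IsClosed Z) (hY : IsClosed Y)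
    (hYi : IsIrreducible Y) (h : Z ⊂ Y) {n : ℕ} (hd : topologicalKrullDim Y ≤ (n + 1 : ℕ)) :
    topologicalKrullDim Z ≤ n := by
  rw [topologicalKrullDim_le_iff_length_le hZ]
  rw [topologicalKrullDim_le_iff_length_le hY] at hd
  intro c hc
  have hlt : c.last < (⟨Y, hYi, hY⟩ : IrreducibleCloseds X) := hc.trans_ssubset h
  have h1 := hd (c.snoc _ hlt) (by rw [RelSeries.last_snoc]; exact subset_rfl)
  exact Nat.le_of_succ_le_succ h1

theorem eq_empty_of_ssubset_of_topologicalKrullDim_le_zero {Z Y : Set X} (hZ : IsClosed Z)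
    (hY : IsClosed Y) (hYi : IsIrreducible Y) (h : Z ⊂ Y)
    (hd : topologicalKrullDim Y ≤ (0 : ℕ)) : Z = ∅ := by
  by_contra hne
  obtain ⟨x, hx⟩ := Set.nonempty_iff_ne_empty.mpr hne
  rw [topologicalKrullDim_le_iff_length_le hY] at hd
  have hc : closure {x} ⊆ Z := closure_minimal (by simpa using hx) hZ
  have hlt : (RelSeries.singleton {(a, b) : IrreducibleCloseds X × IrreducibleCloseds X | a < b}
      ⟨closure {x}, isIrreducible_singleton.closure, isClosed_closure⟩).last <
      (⟨Y, hYi, hY⟩ : IrreducibleCloseds X) := hc.trans_ssubset h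
  have h1 := hd (RelSeries.snoc _ _ hlt) (by rw [RelSeries.last_snoc]; exact subset_rfl)
  exact absurd h1 (Nat.not_succ_le_zero _)

end KrullDim

/-! ### Eventually polynomial functions and their differences -/

section EventuallyPolynomial

open Polynomial

/-- The function `h` agrees for large arguments with a polynomial of degree at most `n` whose
coefficient of `X ^ n` is `c`. -/
def IsEvPoly (n : ℕ) (c : ℚ) (h : ℕ → ℚ) : Prop :=
  ∃ P : ℚ[X], P.natDegree ≤ n ∧ P.coeff n = c ∧ ∀ᶠ m : ℕ in atTop, h m = P.eval (m : ℚ)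

theorem Polynomial.coeff_nonneg_of_eventually_nonneg {P : ℚ[X]} {n : ℕ} (hn : P.natDegree ≤ n)
    (h : ∀ᶠ m : ℕ in atTop, 0 ≤ P.eval (m : ℚ)) : 0 ≤ P.coeff n := by
  by_contra! hc
  have hdeg : P.natDegree = n := le_antisymm hn (le_natDegree_of_ne_zero hc.ne)
  have hl : P.leadingCoeff < 0 := by rwa [leadingCoeff, hdeg]
  rcases Nat.eq_zero_or_pos n with rfl | hpos
  · rw [eq_C_of_natDegree_eq_zero hdeg] at h
    obtain ⟨m, hm⟩ := h.exists
    simp at hm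
    linarith
  · have ht := (P.tendsto_atBot_of_leadingCoeff_nonpos
      (natDegree_pos_iff_degree_pos.mp (hdeg ▸ hpos)) hl.le).comp tendsto_natCast_atTop_atTop
    obtain ⟨m, hm1, hm2⟩ := (h.and (ht.eventually (eventually_lt_atBot 0))).exists
    simp only [Function.comp] at hm2
    linarith

theorem Polynomial.eq_of_eventually_eval_eq {P Q : ℚ[X]}
    (h : ∀ᶠ m : ℕ in atTop, P.eval (m : ℚ) = Q.eval (m : ℚ)) : P = Q := by
  obtain ⟨N, hN⟩ := eventually_atTop.mp h
  refine eq_of_infinite_eval_eq P Q ?_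
  refine Set.infinite_of_injective_forall_mem (f := fun m : ℕ => ((N + m : ℕ) : ℚ))
    (fun a b hab => by simpa using hab) fun m => hN _ (by omega)

namespace Polynomial

theorem coeff_comp_X_add_C_sub (P : ℚ[X]) {n : ℕ} (hn : P.natDegree ≤ n + 1) (d : ℚ) :
    (P.comp (X + C d) - P).natDegree ≤ n ∧
      (P.comp (X + C d) - P).coeff n = (n + 1) * d * P.coeff (n + 1) := by
  have hc : ∀ j, (P.comp (X + C d)).coeff j =
      ∑ i ∈ Finset.range (n + 2), P.coeff i * (d ^ (i - j) * (i.choose j : ℚ)) := by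
    intro j
    conv_lhs => rw [P.as_sum_range' (n + 2) (by omega)]
    rw [Polynomial.sum_comp, finsetSum_coeff]
    refine Finset.sum_congr rfl fun i _ => ?_
    rw [monomial_comp, coeff_C_mul, coeff_X_add_C_pow]
  constructor
  · rw [natDegree_le_iff_coeff_eq_zero]
    intro j hj
    rw [coeff_sub, hc, sub_eq_zero]
    rcases (show n + 1 ≤ j from hj).eq_or_lt with rfl | hj2
    · rw [Finset.sum_range_succ, Finset.sum_eq_zero]
      · simp
      · intro i hi
        rw [Nat.choose_eq_zero_of_lt (Finset.mem_range.mp hi)]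
        simp
    · rw [coeff_eq_zero_of_natDegree_lt (by omega), Finset.sum_eq_zero]
      intro i hi
      rw [Nat.choose_eq_zero_of_lt (by have := Finset.mem_range.mp hi; omega)]
      simp
  · rw [coeff_sub, hc, Finset.sum_range_succ, Finset.sum_range_succ, Finset.sum_eq_zero]
    · simp
      ring
    · intro i hi
      rw [Nat.choose_eq_zero_of_lt (Finset.mem_range.mp hi)]
      simp

/-- A suitable multiple of X^(n+2) has a difference with the same leading term as Q; the remainder
is handled by induction. -/
theorem exists_comp_X_add_one_sub_eq {n : ℕ} (Q : ℚ[X]) (hQ : Q.natDegree ≤ n) :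
    ∃ P : ℚ[X], P.natDegree ≤ n + 1 ∧ P.comp (X + C 1) - P = Q := by
  induction n generalizing Q with
  | zero =>
    refine ⟨C (Q.coeff 0) * X, (natDegree_C_mul_le _ _).trans natDegree_X_le, ?_⟩
    conv_rhs => rw [eq_C_of_natDegree_le_zero hQ]
    simp
    ring
  | succ n ih =>
    set R : ℚ[X] := C (Q.coeff (n + 1) / (n + 2)) * X ^ (n + 2) with hR
    have hRd : R.natDegree ≤ n + 2 := natDegree_C_mul_X_pow_le _ _
    have h1 := coeff_comp_X_add_C_sub R hRd 1
    have hRc : R.coeff (n + 1 + 1) = Q.coeff (n + 1) / (n + 2) := by simp [hR]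
    have h2 : (Q - (R.comp (X + C 1) - R)).natDegree ≤ n := by
      rw [natDegree_le_iff_coeff_eq_zero]
      intro j hj
      rcases (show n + 1 ≤ j from hj).eq_or_lt with rfl | hj2
      · rw [coeff_sub, h1.2, hRc]
        push_cast
        field_simp
        ring
      · rw [coeff_sub, coeff_eq_zero_of_natDegree_lt (by omega),
          coeff_eq_zero_of_natDegree_lt (h1.1.trans_lt hj2), sub_zero]
    obtain ⟨P, hP, hP'⟩ := ih _ h2
    refine ⟨P + R, (natDegree_add_le _ _).trans (max_le (hP.trans (by omega)) hRd), ?_⟩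
    rw [add_comp]
    linear_combination hP'

end Polynomial

namespace IsEvPoly

variable {n : ℕ} {c c' : ℚ} {h h' : ℕ → ℚ}

theorem congr' (H : IsEvPoly n c h) (e : ∀ᶠ m in atTop, h' m = h m) : IsEvPoly n c h' := by
  obtain ⟨P, h1, h2, h3⟩ := H
  exact ⟨P, h1, h2, by filter_upwards [h3, e] with m a b; rw [b, a]⟩

theorem congr (H : IsEvPoly n c h) (e : ∀ m, h' m = h m) : IsEvPoly n c h' :=
  H.congr' (Eventually.of_forall e)

theorem add (H : IsEvPoly n c h) (H' : IsEvPoly n c' h') :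
    IsEvPoly n (c + c') (fun m => h m + h' m) := by
  obtain ⟨P, h1, h2, h3⟩ := H
  obtain ⟨P', h1', h2', h3'⟩ := H'
  exact ⟨P + P', (natDegree_add_le _ _).trans (max_le h1 h1'), by rw [coeff_add, h2, h2'],
    by filter_upwards [h3, h3'] with m a b; rw [a, b, eval_add]⟩

theorem sub (H : IsEvPoly n c h) (H' : IsEvPoly n c' h') :
    IsEvPoly n (c - c') (fun m => h m - h' m) := by
  obtain ⟨P, h1, h2, h3⟩ := H
  obtain ⟨P', h1', h2', h3'⟩ := H'
  exact ⟨P - P', (natDegree_sub_le _ _).trans (max_le h1 h1'), by rw [coeff_sub, h2, h2'],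
    by filter_upwards [h3, h3'] with m a b; rw [a, b, eval_sub]⟩

theorem of_eventually_zero (e : ∀ᶠ m in atTop, h m = 0) : IsEvPoly n 0 h :=
  ⟨0, by simp, by simp, by simpa using e⟩

theorem succ (H : IsEvPoly n c h) : IsEvPoly (n + 1) 0 h := by
  obtain ⟨P, h1, -, h3⟩ := H
  exact ⟨P, by omega, coeff_eq_zero_of_natDegree_lt (by omega), h3⟩

theorem pred (H : IsEvPoly (n + 1) 0 h) : ∃ c, IsEvPoly n c h := by
  obtain ⟨P, h1, h2, h3⟩ := H
  refine ⟨P.coeff n, P, ?_, rfl, h3⟩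
  by_contra! hlt
  have : P.natDegree = n + 1 := by omega
  have h4 : P ≠ 0 := by rintro rfl; simp at hlt
  rw [← this] at h2
  exact h4 (leadingCoeff_eq_zero.mp h2)

theorem le (H : IsEvPoly n c h) (H' : IsEvPoly n c' h') (e : ∀ᶠ m in atTop, h m ≤ h' m) :
    c ≤ c' := by
  obtain ⟨P, h1, h2, h3⟩ := H'.sub H
  rw [← sub_nonneg, ← h2]
  refine coeff_nonneg_of_eventually_nonneg h1 ?_
  filter_upwards [e, h3] with m a b
  rw [← b]
  linarith

theorem unique (H : IsEvPoly n c h) (H' : IsEvPoly n c' h) : c = c' :=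
  le_antisymm (H.le H' (by simp)) (H'.le H (by simp))

theorem comp_add (H : IsEvPoly n c h) (d : ℕ) : IsEvPoly n c (fun m => h (m + d)) := by
  obtain ⟨P, h1, h2, h3⟩ := H
  refine ⟨P.comp (X + C (d : ℚ)), by rwa [natDegree_comp, natDegree_X_add_C, mul_one], ?_, ?_⟩
  · have key := coeff_comp_X_add_C_sub P (h1.trans n.le_succ) (d : ℚ)
    have hz := coeff_eq_zero_of_natDegree_lt (Nat.lt_succ_of_le h1)
    rw [Nat.succ_eq_add_one] at hz
    have := key.2
    rw [hz, coeff_sub] at this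
    linarith
  · filter_upwards [(tendsto_add_atTop_nat d).eventually h3] with m hm
    simp [hm]

theorem of_comp_add (d : ℕ) (H : IsEvPoly n c (fun m => h (m + d))) : IsEvPoly n c h := by
  obtain ⟨P, h1, h2, h3⟩ := H
  have hd : IsEvPoly n c (fun m => (P.comp (X - C (d : ℚ))).eval (m : ℚ)) := by
    have h5 : (P.comp (X - C (d : ℚ))).natDegree ≤ n := by
      rwa [natDegree_comp, natDegree_X_sub_C, mul_one]
    refine ⟨_, h5, ?_, by simp⟩
    have h4 : IsEvPoly n ((P.comp (X - C (d : ℚ))).coeff n)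
        (fun m => (P.comp (X - C (d : ℚ))).eval (m : ℚ)) := ⟨_, h5, rfl, by simp⟩
    refine (h4.comp_add d).unique ⟨P, h1, h2, by simp⟩
  refine hd.congr' ?_
  have h3' : ∀ᶠ m : ℕ in atTop, h (m + d) = eval ((m + d : ℕ) : ℚ) (P.comp (X - C (d : ℚ))) := by
    filter_upwards [h3] with m hm
    simp [hm]
  have := (eventually_map (m := fun m => m + d) (f := atTop)
    (P := fun m : ℕ => h m = eval (m : ℚ) (P.comp (X - C (d : ℚ))))).mpr h3'
  rwa [map_add_atTop_eq_nat] at this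

theorem diff (H : IsEvPoly (n + 1) c h) (d : ℕ) :
    IsEvPoly n ((n + 1) * d * c) (fun m => h (m + d) - h m) := by
  obtain ⟨P, h1, h2, h3⟩ := H
  have key := coeff_comp_X_add_C_sub P h1 (d : ℚ)
  refine ⟨_, key.1, by rw [key.2, h2], ?_⟩
  filter_upwards [h3, (tendsto_add_atTop_nat d).eventually h3] with m hm hm'
  simp [hm, hm']

theorem eventually_eq (H : IsEvPoly 0 c h) : ∀ᶠ m in atTop, h m = c := by
  obtain ⟨P, h1, h2, h3⟩ := H
  filter_upwards [h3] with m hm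
  rw [hm, eq_C_of_natDegree_le_zero h1, h2, eval_C]

theorem of_eventually_eq (H : ∀ᶠ m in atTop, h m = c) : IsEvPoly 0 c h :=
  ⟨C c, by simp, by simp, by simpa using H⟩

theorem exists_of_diff_zero (H : ∀ᶠ m in atTop, h (m + 1) - h m = 0) : ∃ c, IsEvPoly 0 c h := by
  obtain ⟨N, hN⟩ := eventually_atTop.mp H
  refine ⟨h N, of_eventually_eq (eventually_atTop.mpr ⟨N, fun m hm => ?_⟩)⟩
  induction m, hm using Nat.le_induction with
  | base => rfl
  | succ m hm ih => linarith [hN m hm]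

theorem exists_of_diff (H : IsEvPoly n c (fun m => h (m + 1) - h m)) :
    ∃ c', IsEvPoly (n + 1) c' h := by
  obtain ⟨Q, h1, h2, h3⟩ := H
  obtain ⟨P, hP, hPQ⟩ := exists_comp_X_add_one_sub_eq Q h1
  have h4 : ∀ᶠ m : ℕ in atTop,
      (fun m : ℕ => h m - P.eval (m : ℚ)) (m + 1) - (fun m : ℕ => h m - P.eval (m : ℚ)) m = 0 := by
    filter_upwards [h3] with m hm
    have : Q.eval (m : ℚ) = P.eval ((m + 1 : ℕ) : ℚ) - P.eval (m : ℚ) := by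
      rw [← hPQ]; simp
    linarith
  obtain ⟨e, he⟩ := exists_of_diff_zero (h := fun m : ℕ => h m - P.eval (m : ℚ)) h4
  refine ⟨_, P + C e, (natDegree_add_le _ _).trans (max_le hP (by simp)), rfl, ?_⟩
  filter_upwards [he.eventually_eq] with m hm
  simp
  linarith

/-- The zero coefficient says that the difference has degree below n. This form also covers n = 0,
where the difference is eventually zero. -/
theorem exists_of_diff' (H : IsEvPoly n 0 (fun m => h (m + 1) - h m)) : ∃ c', IsEvPoly n c' h := by
  cases n with
  | zero => exact exists_of_diff_zero H.eventually_eq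
  | succ n =>
    obtain ⟨c, hc⟩ := H.pred
    exact hc.exists_of_diff

theorem comp_mul (H : IsEvPoly n c h) {d : ℕ} (hd : 1 ≤ d) :
    IsEvPoly n (c * d ^ n) (fun m => h (d * m)) := by
  obtain ⟨P, h1, h2, h3⟩ := H
  refine ⟨P.comp (C (d : ℚ) * X), ?_, by rw [comp_C_mul_X_coeff, h2], ?_⟩
  · refine natDegree_comp_le.trans ?_
    calc _ ≤ P.natDegree * 1 := Nat.mul_le_mul_left _ ((natDegree_C_mul_le _ _).trans natDegree_X_le)
      _ ≤ n := by omega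
  · have ht : Tendsto (fun m : ℕ => d * m) atTop atTop := tendsto_id.const_mul_atTop' hd
    filter_upwards [ht.eventually h3] with m hm
    simp [hm]

/-- The number n!·c is the eventual constant value of the n-th difference of the integer sequence.
-/
theorem exists_int (z : ℕ → ℤ) (H : IsEvPoly n c (fun m => z m)) :
    ∃ a : ℤ, (n.factorial : ℚ) * c = a := by
  induction n generalizing c z with
  | zero =>
    obtain ⟨m, hm⟩ := H.eventually_eq.exists
    exact ⟨z m, by simp [hm]⟩
  | succ n ih =>
    obtain ⟨a, ha⟩ := ih (fun m => z (m + 1) - z m) ((H.diff 1).congr fun m => by push_cast; rfl)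
    refine ⟨a, ?_⟩
    rw [← ha, Nat.factorial_succ]
    push_cast
    ring

end IsEvPoly

end EventuallyPolynomial

/-! ### Dimension counts for images of a subspace -/

section LinearAlgebra

variable {K M A B : Type*} [Field K] [AddCommGroup M] [Module K M] [AddCommGroup A] [Module K A]
  [AddCommGroup B] [Module K B]

theorem Submodule.finrank_map_add_finrank_inf_ker (N : Submodule K M) [FiniteDimensional K N]
    (f : M →ₗ[K] A) :
    Module.finrank K (N.map f) + Module.finrank K (N ⊓ LinearMap.ker f : Submodule K M) =
      Module.finrank K N := by
  have h := (f.domRestrict N).finrank_range_add_finrank_ker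
  rw [LinearMap.range_domRestrict] at h
  rw [← h]
  congr 1
  have e : (LinearMap.ker (f.domRestrict N)).map N.subtype = N ⊓ LinearMap.ker f := by
    ext x
    simp [and_comm]
  rw [← e]
  exact (LinearEquiv.finrank_eq (Submodule.equivMapOfInjective _ N.injective_subtype _)).symm

theorem Submodule.finrank_map_le_of_ker (N : Submodule K M) [FiniteDimensional K N]
    (f : M →ₗ[K] A) (g : M →ₗ[K] B) (h : ∀ x ∈ N, f x = 0 → g x = 0) :
    Module.finrank K (N.map g) ≤ Module.finrank K (N.map f) := by
  have h1 := N.finrank_map_add_finrank_inf_ker f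
  have h2 := N.finrank_map_add_finrank_inf_ker g
  have h3 : N ⊓ LinearMap.ker f ≤ N ⊓ LinearMap.ker g := fun x hx => ⟨hx.1, h x hx.1 hx.2⟩
  have : FiniteDimensional K (N ⊓ LinearMap.ker g : Submodule K M) :=
    Submodule.finiteDimensional_of_le inf_le_left
  have h4 := Submodule.finrank_mono h3
  omega

theorem Submodule.finrank_map_eq_of_ker (N : Submodule K M) [FiniteDimensional K N]
    (f : M →ₗ[K] A) (g : M →ₗ[K] B) (h : ∀ x ∈ N, f x = 0 ↔ g x = 0) :
    Module.finrank K (N.map g) = Module.finrank K (N.map f) :=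
  le_antisymm (N.finrank_map_le_of_ker f g fun x hx => (h x hx).1)
    (N.finrank_map_le_of_ker g f fun x hx => (h x hx).2)

/-- On N the kernel of f lies in that of g, so f(N) surjects onto g(N) with kernel f(N ∩ ker g). -/
theorem Submodule.finrank_map_eq_add (N : Submodule K M) [FiniteDimensional K N]
    (f : M →ₗ[K] A) (g : M →ₗ[K] B) (h : ∀ x ∈ N, f x = 0 → g x = 0) :
    Module.finrank K (N.map f) = Module.finrank K ((N ⊓ LinearMap.ker g).map f) +
      Module.finrank K (N.map g) := by
  have : FiniteDimensional K (N ⊓ LinearMap.ker g : Submodule K M) :=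
    Submodule.finiteDimensional_of_le inf_le_left
  have h1 := N.finrank_map_add_finrank_inf_ker f
  have h2 := N.finrank_map_add_finrank_inf_ker g
  have h3 := (N ⊓ LinearMap.ker g).finrank_map_add_finrank_inf_ker f
  have e : N ⊓ LinearMap.ker g ⊓ LinearMap.ker f = N ⊓ LinearMap.ker f :=
    le_antisymm (fun x hx => ⟨hx.1.1, hx.2⟩) fun x hx => ⟨⟨hx.1, h x hx.1 hx.2⟩, hx.2⟩
  rw [e] at h3
  omega

end LinearAlgebra

/-- The ideal `(J : s)`. -/
def Ideal.colonElem {R : Type*} [CommRing R] (J : Ideal R) (s : R) : Ideal R :=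
  Submodule.comap (LinearMap.mulLeft R s) J

theorem Ideal.mem_colonElem {R : Type*} [CommRing R] {J : Ideal R} {s g : R} :
    g ∈ J.colonElem s ↔ s * g ∈ J := Iff.rfl

theorem Ideal.le_colonElem {R : Type*} [CommRing R] (J : Ideal R) (s : R) : J ≤ J.colonElem s :=
  fun _ hg => J.mul_mem_left s hg

theorem mkₐ_toLinearMap_eq_zero {σ : Type*} {J : Ideal (MvPolynomial σ ℂ)}
    {g : MvPolynomial σ ℂ} : (Ideal.Quotient.mkₐ ℂ J).toLinearMap g = 0 ↔ g ∈ J := by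
  simp [Ideal.Quotient.eq_zero_iff_mem]

theorem MvPolynomial.eval_mul_of_forall_support {ι : Type*} [Fintype ι] {t x : ι → ℂ} {g : MvPolynomial ι ℂ} {c : ℂ}
    (h : ∀ b, MvPolynomial.coeff b g ≠ 0 → ∏ ρ, t ρ ^ b ρ = c) :
    MvPolynomial.eval (fun ρ => t ρ * x ρ) g = c * MvPolynomial.eval x g := by
  rw [MvPolynomial.eval_eq', MvPolynomial.eval_eq', Finset.mul_sum]
  refine Finset.sum_congr rfl fun b hb => ?_
  simp_rw [mul_pow]
  rw [Finset.prod_mul_distrib, h b (MvPolynomial.mem_support_iff.mp hb)]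
  ring

namespace SimplicialFan

variable {n : ℕ} {ι : Type*} [Fintype ι] [DecidableEq ι] (Φ : SimplicialFan n ι)

/-! ### The grading of the Cox ring -/

/-- The degrees of the variables of the Cox ring. -/
def wt : ι → Φ.Cl := fun ρ => Φ.cls (Pi.single ρ 1)

theorem cls_eq_mkQ (a : ι → ℤ) : Φ.cls a = (LinearMap.range Φ.divChar).mkQ a := rfl

theorem cls_add (a b : ι → ℤ) : Φ.cls (a + b) = Φ.cls a + Φ.cls b := by simp [cls_eq_mkQ]

theorem cls_sub (a b : ι → ℤ) : Φ.cls (a - b) = Φ.cls a - Φ.cls b := by simp [cls_eq_mkQ]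

theorem cls_zsmul (k : ℤ) (a : ι → ℤ) : Φ.cls (k • a) = k • Φ.cls a :=
  map_zsmul (LinearMap.range Φ.divChar).mkQ k a

theorem cls_nsmul (k : ℕ) (a : ι → ℤ) : Φ.cls (k • a) = k • Φ.cls a := by
  rw [← natCast_zsmul, cls_zsmul, natCast_zsmul]

theorem cls_divChar (u : Fin n → ℤ) : Φ.cls (Φ.divChar u) = 0 := by
  rw [cls_eq_mkQ, Submodule.mkQ_apply, Submodule.Quotient.mk_eq_zero]
  exact ⟨u, rfl⟩

theorem cls_eq_cls_iff {a b : ι → ℤ} : Φ.cls a = Φ.cls b ↔ ∃ u, a = b + Φ.divChar u := by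
  unfold cls
  rw [Submodule.Quotient.eq]
  constructor
  · rintro ⟨u, hu⟩
    exact ⟨u, by rw [hu]; abel⟩
  · rintro ⟨u, rfl⟩
    exact ⟨u, by abel⟩

theorem exists_cls_eq (α : Φ.Cl) : ∃ a, Φ.cls a = α := Submodule.Quotient.mk_surjective _ α

theorem divChar_apply (u : Fin n → ℤ) (ρ : ι) : Φ.divChar u ρ = u ⬝ᵥ Φ.gen ρ := rfl

/-- The degree of the monomial with exponent `b`. -/
def mdeg (b : ι →₀ ℕ) : Φ.Cl := Φ.cls (fun ρ => (b ρ : ℤ))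

theorem weight_eq_mdeg (b : ι →₀ ℕ) : Finsupp.weight Φ.wt b = Φ.mdeg b := by
  rw [Finsupp.weight_apply, Finsupp.sum_fintype _ _ (by simp), mdeg]
  have : (fun ρ => (b ρ : ℤ)) = ∑ ρ, (b ρ) • (Pi.single ρ 1 : ι → ℤ) := by
    ext ρ
    simp [Finset.sum_apply, Pi.single_apply]
  rw [this, cls_eq_mkQ, map_sum]
  refine Finset.sum_congr rfl fun ρ _ => ?_
  rw [map_nsmul]
  rfl

variable {Φ}

theorem mem_S_iff {α : Φ.Cl} {g : MvPolynomial ι ℂ} :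
    g ∈ Φ.S α ↔ ∀ b, MvPolynomial.coeff b g ≠ 0 → Φ.mdeg b = α := by
  have : g ∈ Φ.S α ↔ MvPolynomial.IsWeightedHomogeneous Φ.wt g α := Iff.rfl
  rw [this]
  unfold MvPolynomial.IsWeightedHomogeneous
  simp only [weight_eq_mdeg]

theorem isWeightedHomogeneous_of_mem_S {α : Φ.Cl} {g : MvPolynomial ι ℂ} (h : g ∈ Φ.S α) :
    MvPolynomial.IsWeightedHomogeneous Φ.wt g α := h

theorem mul_mem_S {α γ : Φ.Cl} {s g : MvPolynomial ι ℂ} (hs : s ∈ Φ.S γ) (hg : g ∈ Φ.S α) :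
    s * g ∈ Φ.S (γ + α) :=
  (isWeightedHomogeneous_of_mem_S hs).mul (isWeightedHomogeneous_of_mem_S hg)

theorem pow_mem_S {γ : Φ.Cl} {s : MvPolynomial ι ℂ} (hs : s ∈ Φ.S γ) (N : ℕ) :
    s ^ N ∈ Φ.S (N • γ) :=
  (isWeightedHomogeneous_of_mem_S hs).pow N

theorem monomial_mem_S (b : ι →₀ ℕ) (c : ℂ) : MvPolynomial.monomial b c ∈ Φ.S (Φ.mdeg b) :=
  MvPolynomial.isWeightedHomogeneous_monomial Φ.wt b c (Φ.weight_eq_mdeg b)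

theorem xHat_eq_monomial (σ : Finset ι) :
    xHat σ = MvPolynomial.monomial (∑ ρ ∈ σᶜ, Finsupp.single ρ 1) (1 : ℂ) := by
  rw [xHat, MvPolynomial.monomial_sum_one]
  rfl

variable (Φ) in
theorem mdeg_xHat (σ : Finset ι) : Φ.mdeg (∑ ρ ∈ σᶜ, Finsupp.single ρ 1) = Φ.degHat σ := by
  rw [← weight_eq_mdeg, map_sum, degHat]
  refine Finset.sum_congr rfl fun ρ _ => ?_
  rw [Finsupp.weight_single]
  simp [wt]

theorem xHat_mem_S (σ : Finset ι) : xHat σ ∈ Φ.S (Φ.degHat σ) := by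
  rw [xHat_eq_monomial, ← mdeg_xHat]
  exact monomial_mem_S _ _

variable (Φ) in
/-- The component of degree `α` of a polynomial. -/
noncomputable def comp (α : Φ.Cl) : MvPolynomial ι ℂ →ₗ[ℂ] MvPolynomial ι ℂ :=
  MvPolynomial.weightedHomogeneousComponent Φ.wt α

theorem comp_mem_S (α : Φ.Cl) (g : MvPolynomial ι ℂ) : Φ.comp α g ∈ Φ.S α :=
  MvPolynomial.weightedHomogeneousComponent_isWeightedHomogeneous α g

theorem comp_of_mem {α : Φ.Cl} {g : MvPolynomial ι ℂ} (hg : g ∈ Φ.S α) : Φ.comp α g = g :=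
  MvPolynomial.IsWeightedHomogeneous.weightedHomogeneousComponent_same hg

theorem comp_of_mem_ne {α δ : Φ.Cl} {g : MvPolynomial ι ℂ} (hg : g ∈ Φ.S α) (h : δ ≠ α) :
    Φ.comp δ g = 0 :=
  MvPolynomial.IsWeightedHomogeneous.weightedHomogeneousComponent_ne δ hg h

variable (Φ) in
theorem exists_eq_sum_comp (g : MvPolynomial ι ℂ) :
    ∃ T : Finset Φ.Cl, g = ∑ α ∈ T, Φ.comp α g := by
  refine ⟨(MvPolynomial.weightedHomogeneousComponent_finsupp (w := Φ.wt) g).toFinset, ?_⟩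
  conv_lhs => rw [← MvPolynomial.sum_weightedHomogeneousComponent Φ.wt g]
  exact finsum_eq_sum _ _

theorem comp_mul {γ : Φ.Cl} {s : MvPolynomial ι ℂ} (hs : s ∈ Φ.S γ) (δ : Φ.Cl)
    (g : MvPolynomial ι ℂ) : Φ.comp (γ + δ) (s * g) = s * Φ.comp δ g := by
  classical
  obtain ⟨T, hT⟩ := Φ.exists_eq_sum_comp g
  have h1 : ∀ α, Φ.comp (γ + δ) (s * Φ.comp α g) = if α = δ then s * Φ.comp α g else 0 := by
    intro α
    have := mul_mem_S hs (comp_mem_S α g)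
    split_ifs with h
    · subst h
      exact comp_of_mem this
    · exact comp_of_mem_ne this fun h' => h (add_left_cancel h').symm
  have h2 : ∀ α, Φ.comp δ (Φ.comp α g) = if α = δ then Φ.comp α g else 0 := by
    intro α
    split_ifs with h
    · subst h
      exact comp_of_mem (comp_mem_S _ g)
    · exact comp_of_mem_ne (comp_mem_S _ g) fun h' => h h'.symm
  conv_lhs => rw [hT, Finset.mul_sum, map_sum]
  conv_rhs => rw [hT, map_sum, Finset.mul_sum]
  refine Finset.sum_congr rfl fun α _ => ?_
  rw [h1, h2]
  split_ifs <;> simp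

/-! ### Homogeneous ideals -/

variable (Φ) in
/-- The ideal `J` of the Cox ring is homogeneous. -/
def IsHomog (J : Ideal (MvPolynomial ι ℂ)) : Prop := ∀ g ∈ J, ∀ α, Φ.comp α g ∈ J

theorem IsHomog.sup {J J' : Ideal (MvPolynomial ι ℂ)} (h : Φ.IsHomog J) (h' : Φ.IsHomog J') :
    Φ.IsHomog (J ⊔ J') := by
  intro g hg α
  obtain ⟨a, ha, b, hb, rfl⟩ := Submodule.mem_sup.mp hg
  rw [map_add]
  exact Submodule.add_mem_sup (h a ha α) (h' b hb α)

theorem isHomog_span_singleton {γ : Φ.Cl} {s : MvPolynomial ι ℂ} (hs : s ∈ Φ.S γ) :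
    Φ.IsHomog (Ideal.span {s}) := by
  intro g hg α
  obtain ⟨h, rfl⟩ := Ideal.mem_span_singleton.mp hg
  rw [← add_sub_cancel γ α, comp_mul hs]
  exact Ideal.mul_mem_right _ _ (Ideal.mem_span_singleton_self s)

theorem IsHomog.colonElem {J : Ideal (MvPolynomial ι ℂ)} (h : Φ.IsHomog J) {γ : Φ.Cl}
    {s : MvPolynomial ι ℂ} (hs : s ∈ Φ.S γ) : Φ.IsHomog (J.colonElem s) := by
  intro g hg α
  rw [Ideal.mem_colonElem, ← comp_mul hs]
  exact h _ hg _

/-! ### Finite-dimensionality of the graded pieces -/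

variable (Φ) in
theorem exists_nonneg_combination (x : Fin n → ℤ) : ∃ σ ∈ Φ.cones, ∃ l : ι → ℝ, (∀ ρ, 0 ≤ l ρ) ∧
    ∀ u : Fin n → ℤ, ((u ⬝ᵥ x : ℤ) : ℝ) = ∑ ρ ∈ σ, l ρ * ((u ⬝ᵥ Φ.gen ρ : ℤ) : ℝ) := by
  obtain ⟨σ, hσ, hx⟩ := Φ.complete (fun i => (x i : ℝ))
  refine ⟨σ, hσ, ?_⟩
  rw [PointedCone.hull, Submodule.mem_span_image_finset_iff_exists_fun'] at hx
  obtain ⟨l, hl⟩ := hx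
  refine ⟨fun ρ => (l ρ : ℝ), fun ρ => (l ρ).2, fun u => ?_⟩
  have h1 : ∀ i, (x i : ℝ) = ∑ ρ ∈ σ, (l ρ : ℝ) * (Φ.gen ρ i : ℝ) := by
    intro i
    have := congrFun hl i
    rw [← this, Finset.sum_apply]
    rfl
  simp only [dotProduct]
  push_cast
  simp_rw [h1, Finset.mul_sum]
  rw [Finset.sum_comm]
  refine Finset.sum_congr rfl fun ρ _ => Finset.sum_congr rfl fun i _ => by ring

-- Monomials of degree α are lattice points of the polyhedron e_ρ + ⟨u, v_ρ⟩ ≥ 0. By completeness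
-- every x is a nonnegative combination of ray generators, so ⟨u, x⟩ is bounded below there; taking
-- x = ± the basis vectors bounds the polyhedron.
variable (Φ) in
theorem finite_mdeg_eq (α : Φ.Cl) : {b : ι →₀ ℕ | Φ.mdeg b = α}.Finite := by
  obtain ⟨e, he⟩ := Φ.exists_cls_eq α
  have key : ∀ x : Fin n → ℤ, ∃ C : ℤ, ∀ u : Fin n → ℤ, (∀ ρ, 0 ≤ e ρ + u ⬝ᵥ Φ.gen ρ) →
      C ≤ u ⬝ᵥ x := by
    intro x
    obtain ⟨σ, -, l, hl, hu⟩ := Φ.exists_nonneg_combination x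
    refine ⟨⌊-∑ ρ ∈ σ, l ρ * e ρ⌋, fun u h => ?_⟩
    have h1 : -∑ ρ ∈ σ, l ρ * (e ρ : ℝ) ≤ ((u ⬝ᵥ x : ℤ) : ℝ) := by
      rw [hu u, ← Finset.sum_neg_distrib]
      refine Finset.sum_le_sum fun ρ _ => ?_
      have h2 : (0 : ℝ) ≤ (e ρ : ℝ) + ((u ⬝ᵥ Φ.gen ρ : ℤ) : ℝ) := by exact_mod_cast h ρ
      nlinarith [hl ρ, mul_nonneg (hl ρ) h2]
    exact_mod_cast (Int.floor_le _).trans h1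
  choose C hC using key
  have hfin : {u : Fin n → ℤ | ∀ ρ, 0 ≤ e ρ + u ⬝ᵥ Φ.gen ρ}.Finite := by
    refine (Set.finite_Icc (fun i => C (Pi.single i 1)) (fun i => -C (-Pi.single i 1))).subset ?_
    intro u hu
    constructor
    · intro i
      simpa using hC (Pi.single i 1) u hu
    · intro i
      have := hC (-Pi.single i 1) u hu
      simp only [dotProduct_neg, dotProduct_single, mul_one] at this
      show u i ≤ -C (-Pi.single i 1)
      linarith
  refine (hfin.image fun u => Finsupp.equivFunOnFinite.symm
    fun ρ => (e ρ + u ⬝ᵥ Φ.gen ρ).toNat).subset ?_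
  intro b hb
  obtain ⟨u, hu⟩ := Φ.cls_eq_cls_iff.mp ((show Φ.cls _ = α from hb).trans he.symm)
  have h1 : ∀ ρ, (b ρ : ℤ) = e ρ + u ⬝ᵥ Φ.gen ρ := fun ρ => congrFun hu ρ
  refine ⟨u, fun ρ => by rw [← h1]; positivity, ?_⟩
  ext ρ
  simp [← h1]

instance finiteDimensional_S (α : Φ.Cl) : FiniteDimensional ℂ (Φ.S α) := by
  have h : Φ.S α = MvPolynomial.restrictSupport ℂ {d | Finsupp.weight Φ.wt d = α} :=
    MvPolynomial.weightedHomogeneousSubmodule_eq_finsupp_supported ℂ Φ.wt α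
  have hf : {d : ι →₀ ℕ | Finsupp.weight Φ.wt d = α}.Finite := by
    simpa only [weight_eq_mdeg] using Φ.finite_mdeg_eq α
  have := hf.to_subtype
  rw [h]
  exact Module.Finite.of_basis (MvPolynomial.basisRestrictSupport ℂ _)

/-! ### Hilbert functions of homogeneous ideals -/

variable (Φ) in
/-- The Hilbert function `dim (S / J)^α`. -/
noncomputable def hilb (J : Ideal (MvPolynomial ι ℂ)) (α : Φ.Cl) : ℕ :=
  Module.finrank ℂ ((Φ.S α).map (Ideal.Quotient.mkₐ ℂ J).toLinearMap)

theorem hilb_le_of_forall_mem {J J' : Ideal (MvPolynomial ι ℂ)} {α : Φ.Cl}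
    (h : ∀ g ∈ Φ.S α, g ∈ J → g ∈ J') : Φ.hilb J' α ≤ Φ.hilb J α :=
  Submodule.finrank_map_le_of_ker _ _ _ fun g hg h0 =>
    mkₐ_toLinearMap_eq_zero.mpr (h g hg (mkₐ_toLinearMap_eq_zero.mp h0))

theorem hilb_anti {J J' : Ideal (MvPolynomial ι ℂ)} (h : J ≤ J') (α : Φ.Cl) :
    Φ.hilb J' α ≤ Φ.hilb J α :=
  hilb_le_of_forall_mem fun _ _ hg => h hg

theorem hilb_eq_zero {J : Ideal (MvPolynomial ι ℂ)} {α : Φ.Cl} (h : ∀ g ∈ Φ.S α, g ∈ J) :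
    Φ.hilb J α = 0 := by
  have : (Φ.S α).map (Ideal.Quotient.mkₐ ℂ J).toLinearMap = ⊥ := by
    refine LinearMap.le_ker_iff_map.mp ?_
    exact fun g hg => mkₐ_toLinearMap_eq_zero.mpr (h g hg)
  rw [hilb, this, finrank_bot]

theorem one_le_hilb {J : Ideal (MvPolynomial ι ℂ)} {α : Φ.Cl} {g : MvPolynomial ι ℂ}
    (hg : g ∈ Φ.S α) (hJ : g ∉ J) : 1 ≤ Φ.hilb J α := by
  rw [hilb, Nat.one_le_iff_ne_zero, Ne, Submodule.finrank_eq_zero, ← LinearMap.le_ker_iff_map]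
  exact fun h => hJ (mkₐ_toLinearMap_eq_zero.mp (h hg))

/-- Multiplication by s gives the exact sequence 0 → (S/(J : s))^δ → (S/J)^{γ+δ} → (S/(J +
(s)))^{γ+δ} → 0. Homogeneity of J allows the cofactor of s to be replaced by its component of degree
δ. -/
theorem hilb_eq_add {J : Ideal (MvPolynomial ι ℂ)} (hJ : Φ.IsHomog J) {γ : Φ.Cl}
    {s : MvPolynomial ι ℂ} (hs : s ∈ Φ.S γ) (δ : Φ.Cl) :
    Φ.hilb J (γ + δ) = Φ.hilb (J.colonElem s) δ + Φ.hilb (J ⊔ Ideal.span {s}) (γ + δ) := by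
  set f := (Ideal.Quotient.mkₐ ℂ J).toLinearMap
  set g := (Ideal.Quotient.mkₐ ℂ (J ⊔ Ideal.span {s})).toLinearMap
  have h1 := (Φ.S (γ + δ)).finrank_map_eq_add f g fun x _ hx =>
    mkₐ_toLinearMap_eq_zero.mpr (Ideal.mem_sup_left (mkₐ_toLinearMap_eq_zero.mp hx))
  have h2 : (Φ.S (γ + δ) ⊓ LinearMap.ker g).map f =
      (Φ.S δ).map (f ∘ₗ LinearMap.mulLeft ℂ s) := by
    ext y
    constructor
    · rintro ⟨x, ⟨hx1, hx2⟩, rfl⟩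
      obtain ⟨a, ha, b, hb, hab⟩ := Submodule.mem_sup.mp (mkₐ_toLinearMap_eq_zero.mp hx2)
      obtain ⟨c, rfl⟩ := Ideal.mem_span_singleton.mp hb
      refine ⟨Φ.comp δ c, comp_mem_S δ c, ?_⟩
      have h3 : x = Φ.comp (γ + δ) a + s * Φ.comp δ c := by
        rw [← comp_mul hs, ← map_add, hab, comp_of_mem hx1]
      rw [LinearMap.comp_apply, LinearMap.mulLeft_apply, ← sub_eq_zero, ← map_sub,
        mkₐ_toLinearMap_eq_zero, h3, sub_add_cancel_right]
      exact J.neg_mem (hJ a ha _)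
    · rintro ⟨x, hx, rfl⟩
      refine ⟨s * x, ⟨mul_mem_S hs hx, ?_⟩, rfl⟩
      exact mkₐ_toLinearMap_eq_zero.mpr (Ideal.mem_sup_right
        (Ideal.mul_mem_right _ _ (Ideal.mem_span_singleton_self s)))
  have h3 := (Φ.S δ).finrank_map_eq_of_ker
    (Ideal.Quotient.mkₐ ℂ (J.colonElem s)).toLinearMap (f ∘ₗ LinearMap.mulLeft ℂ s) fun x _ => by
      rw [mkₐ_toLinearMap_eq_zero, LinearMap.comp_apply, LinearMap.mulLeft_apply,
        mkₐ_toLinearMap_eq_zero, Ideal.mem_colonElem]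
  rw [h2, h3] at h1
  exact h1

/-! ### The action of `G` on homogeneous polynomials -/

theorem prod_pow_eq_of_mem_G {t : ι → ℂˣ} (ht : t ∈ Φ.G) {b c : ι →₀ ℕ}
    (h : Φ.mdeg b = Φ.mdeg c) : ∏ ρ, t ρ ^ b ρ = ∏ ρ, t ρ ^ c ρ := by
  obtain ⟨u, hu⟩ := Φ.cls_eq_cls_iff.mp h
  have h1 : ∀ ρ, t ρ ^ b ρ = t ρ ^ c ρ * t ρ ^ (u ⬝ᵥ Φ.gen ρ) := by
    intro ρ
    rw [← zpow_natCast, ← zpow_natCast, ← zpow_add]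
    exact congrArg _ (congrFun hu ρ)
  simp_rw [h1]
  rw [Finset.prod_mul_distrib, ht u, mul_one]

theorem exists_eval_smul {α : Φ.Cl} {g : MvPolynomial ι ℂ} (hg : g ∈ Φ.S α) {t : ι → ℂˣ}
    (ht : t ∈ Φ.G) : ∃ c : ℂ, c ≠ 0 ∧ ∀ x : ι → ℂ,
      MvPolynomial.eval (fun ρ => (t ρ : ℂ) * x ρ) g = c * MvPolynomial.eval x g := by
  by_cases h0 : g = 0
  · exact ⟨1, one_ne_zero, by simp [h0]⟩
  · obtain ⟨b, hb⟩ := MvPolynomial.ne_zero_iff.mp h0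
    refine ⟨((∏ ρ, t ρ ^ b ρ : ℂˣ) : ℂ), Units.ne_zero _, fun x => ?_⟩
    refine MvPolynomial.eval_mul_of_forall_support fun c hc => ?_
    rw [← prod_pow_eq_of_mem_G ht ((mem_S_iff.mp hg c hc).trans (mem_S_iff.mp hg b hb).symm)]
    push_cast
    rfl

theorem point_eq_point_iff {x y : Φ.CoxSpace} :
    Φ.point x = Φ.point y ↔ ∃ t ∈ Φ.G, ∀ ρ, y.coord ρ = (t ρ : ℂ) * x.coord ρ :=
  Quotient.eq (r := Φ.orbitSetoid)

theorem exists_point_eq (p : Φ.Variety) : ∃ x, Φ.point x = p :=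
  Quotient.exists_rep p

theorem eval_eq_zero_of_point_eq {α : Φ.Cl} {g : MvPolynomial ι ℂ} (hg : g ∈ Φ.S α)
    {x y : Φ.CoxSpace} (h : Φ.point x = Φ.point y) (hx : MvPolynomial.eval x.coord g = 0) :
    MvPolynomial.eval y.coord g = 0 := by
  obtain ⟨t, ht, hy⟩ := point_eq_point_iff.mp h
  obtain ⟨c, -, hc⟩ := exists_eval_smul hg ht
  rw [show y.coord = fun ρ => (t ρ : ℂ) * x.coord ρ from funext hy, hc, hx, mul_zero]

/-- The translate of a point of the Cox space by an element of `G`. -/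
def CoxSpace.translate (x : Φ.CoxSpace) (t : ι → ℂˣ) : Φ.CoxSpace where
  coord ρ := t ρ * x.coord ρ
  mem := by
    obtain ⟨σ, hσ, h⟩ := x.mem
    exact ⟨σ, hσ, fun ρ hρ => mul_ne_zero (Units.ne_zero _) (h ρ hρ)⟩

theorem point_translate (x : Φ.CoxSpace) {t : ι → ℂˣ} (ht : t ∈ Φ.G) :
    Φ.point (x.translate t) = Φ.point x :=
  (point_eq_point_iff.mpr ⟨t, ht, fun _ => rfl⟩).symm

/-! ### Characters of the class group -/

variable (Φ) in
/-- The element of the torus with coordinates `χ([D_ρ])`. -/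
def charPoint (χ : Multiplicative Φ.Cl →* ℂˣ) : ι → ℂˣ := fun ρ => χ (Multiplicative.ofAdd (Φ.wt ρ))

theorem sum_zsmul_wt (a : ι → ℤ) : ∑ ρ, a ρ • Φ.wt ρ = Φ.cls a := by
  have : a = ∑ ρ, (a ρ) • (Pi.single ρ 1 : ι → ℤ) := by
    ext ρ
    simp [Finset.sum_apply, Pi.single_apply]
  conv_rhs => rw [this, cls_eq_mkQ, map_sum]
  exact Finset.sum_congr rfl fun ρ _ => (Φ.cls_zsmul (a ρ) _).symm

theorem prod_charPoint_zpow (χ : Multiplicative Φ.Cl →* ℂˣ) (a : ι → ℤ) :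
    ∏ ρ, Φ.charPoint χ ρ ^ a ρ = χ (Multiplicative.ofAdd (Φ.cls a)) := by
  rw [← sum_zsmul_wt, ofAdd_sum, map_prod]
  refine Finset.prod_congr rfl fun ρ _ => ?_
  rw [ofAdd_zsmul, map_zpow]
  rfl

theorem charPoint_mem_G (χ : Multiplicative Φ.Cl →* ℂˣ) : Φ.charPoint χ ∈ Φ.G := by
  intro m
  have := prod_charPoint_zpow χ (Φ.divChar m)
  rw [cls_divChar, ofAdd_zero, map_one] at this
  exact this

theorem eval_translate_charPoint (χ : Multiplicative Φ.Cl →* ℂˣ) {α : Φ.Cl} {g : MvPolynomial ι ℂ}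
    (hg : g ∈ Φ.S α) (x : Φ.CoxSpace) :
    MvPolynomial.eval (x.translate (Φ.charPoint χ)).coord g =
      (χ (Multiplicative.ofAdd α) : ℂ) * MvPolynomial.eval x.coord g := by
  refine MvPolynomial.eval_mul_of_forall_support fun b hb => ?_
  rw [← mem_S_iff.mp hg b hb, mdeg, ← prod_charPoint_zpow]
  simp

/-- A ℚ/ℤ-valued character not killing a is composed with r ↦ exp(2πir), which is injective on ℚ/ℤ.
Torsion is allowed, as `Cl` may have some. -/
theorem exists_unitsHom_ne_one {A : Type*} [AddCommGroup A] {a : A} (ha : a ≠ 0) :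
    ∃ χ : Multiplicative A →* ℂˣ, χ (Multiplicative.ofAdd a) ≠ 1 := by
  obtain ⟨c, hc⟩ := CharacterModule.exists_character_apply_ne_zero_of_ne_zero ha
  let e : ℚ →+ Additive ℂˣ :=
    { toFun := fun r => Additive.ofMul
        (Units.mk0 (Complex.exp (2 * Real.pi * Complex.I * r)) (Complex.exp_ne_zero _))
      map_zero' := by
        apply Additive.toMul.injective
        ext
        simp
      map_add' := fun r s => by
        apply Additive.toMul.injective
        ext
        simp [mul_add, Complex.exp_add] }
  have hker : AddSubgroup.zmultiples (1 : ℚ) ≤ e.ker := by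
    rw [AddSubgroup.zmultiples_le]
    show e 1 = 0
    apply Additive.toMul.injective
    ext
    simp [e]
  let E : AddCircle (1 : ℚ) →+ Additive ℂˣ := QuotientAddGroup.lift _ e hker
  refine ⟨AddMonoidHom.toMultiplicativeLeft (E.comp (c : A →+ AddCircle (1 : ℚ))), fun h => hc ?_⟩
  obtain ⟨r, hr⟩ := QuotientAddGroup.mk_surjective (c a)
  have h1 : E (c a) = 0 := h
  rw [← hr] at h1 ⊢
  have h2 : e r = 0 := h1
  have h3 : Complex.exp (2 * Real.pi * Complex.I * r) = 1 := congrArg (fun z => ((Additive.toMul z : ℂˣ) : ℂ)) h2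
  obtain ⟨k, hk⟩ := Complex.exp_eq_one_iff.mp h3
  have hpi : (2 * Real.pi * Complex.I : ℂ) ≠ 0 := Complex.two_pi_I_ne_zero
  have h4 : (r : ℂ) = k := mul_left_cancel₀ hpi (by rw [hk]; ring)
  have h5 : r = k := by exact_mod_cast h4
  rw [QuotientAddGroup.eq_zero_iff, h5, AddSubgroup.mem_zmultiples_iff]
  exact ⟨k, by simp⟩

theorem mem_ideal_iff {Z : Set Φ.Variety} {g : MvPolynomial ι ℂ} :
    g ∈ Φ.ideal Z ↔ ∀ x : Φ.CoxSpace, Φ.point x ∈ Z → MvPolynomial.eval x.coord g = 0 := by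
  rw [ideal, MvPolynomial.mem_vanishingIdeal_iff]
  constructor
  · intro h x hx
    rw [← MvPolynomial.aeval_eq_eval]
    exact h _ ⟨x, hx, rfl⟩
  · rintro h _ ⟨x, hx, rfl⟩
    rw [MvPolynomial.aeval_eq_eval]
    exact h x hx

/-- The preimage of Z is stable under G, so Σ_δ χ(δ)·g_δ(x) = 0 for every character χ of `Cl`.
Characters separate classes, so the maps χ ↦ χ(δ) are distinct, and Dedekind's independence of
characters gives g_δ(x) = 0 for each δ. -/
theorem isHomog_ideal (Z : Set Φ.Variety) : Φ.IsHomog (Φ.ideal Z) := by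
  classical
  intro g hg α
  rw [mem_ideal_iff]
  intro x hx
  obtain ⟨T, hT⟩ := Φ.exists_eq_sum_comp g
  let ev : Φ.Cl → ((Multiplicative Φ.Cl →* ℂˣ) →* ℂ) := fun δ =>
    (Units.coeHom ℂ).comp (MonoidHom.eval (Multiplicative.ofAdd δ))
  have hinj : Function.Injective ev := by
    intro δ δ' h
    by_contra hne
    obtain ⟨χ, hχ⟩ := exists_unitsHom_ne_one (sub_ne_zero.mpr hne)
    have h1 : (χ (Multiplicative.ofAdd δ) : ℂ) = χ (Multiplicative.ofAdd δ') := DFunLike.congr_fun h χ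
    apply hχ
    rw [ofAdd_sub, map_div, Units.ext h1, div_self']
  have hli := (linearIndependent_monoidHom (Multiplicative Φ.Cl →* ℂˣ) ℂ).comp ev hinj
  by_cases hα : α ∈ T
  · refine linearIndependent_iff'.mp hli T (fun δ => MvPolynomial.eval x.coord (Φ.comp δ g)) ?_ α hα
    ext χ
    have h1 := mem_ideal_iff.mp hg (x.translate (Φ.charPoint χ))
      (by rwa [point_translate x (charPoint_mem_G χ)])
    rw [hT, map_sum] at h1
    simp_rw [eval_translate_charPoint χ (comp_mem_S _ g) x] at h1
    rw [Finset.sum_apply, Pi.zero_apply, ← h1]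
    refine Finset.sum_congr rfl fun δ _ => ?_
    simp [ev, mul_comm]
  · have : Φ.comp α g = 0 := by
      rw [hT, map_sum]
      exact Finset.sum_eq_zero fun δ hδ =>
        comp_of_mem_ne (comp_mem_S δ g) fun h => hα (h ▸ hδ)
    rw [this, map_zero]

/-! ### Zero loci -/

variable (Φ) in
/-- The closed subset of `P_Σ` defined by a homogeneous ideal. -/
def zeroLocus (J : Ideal (MvPolynomial ι ℂ)) : Set Φ.Variety :=
  Φ.point '' {x | ∀ g ∈ J, MvPolynomial.eval x.coord g = 0}

theorem point_mem_zeroLocus_iff {J : Ideal (MvPolynomial ι ℂ)} (hJ : Φ.IsHomog J)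
    {x : Φ.CoxSpace} :
    Φ.point x ∈ Φ.zeroLocus J ↔ ∀ g ∈ J, MvPolynomial.eval x.coord g = 0 := by
  refine ⟨?_, fun h => ⟨x, h, rfl⟩⟩
  rintro ⟨y, hy, hyx⟩ g hg
  obtain ⟨T, hT⟩ := Φ.exists_eq_sum_comp g
  rw [hT, map_sum]
  exact Finset.sum_eq_zero fun α _ =>
    eval_eq_zero_of_point_eq (comp_mem_S α g) hyx (hy _ (hJ g hg α))

theorem isClosed_zeroLocus {J : Ideal (MvPolynomial ι ℂ)} (hJ : Φ.IsHomog J) :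
    IsClosed (Φ.zeroLocus J) := by
  have hq : Topology.IsQuotientMap Φ.point := isQuotientMap_quotient_mk'
  rw [← hq.isClosed_preimage, isClosed_induced_iff]
  refine ⟨PrimeSpectrum.zeroLocus (J : Set (MvPolynomial ι ℂ)), PrimeSpectrum.isClosed_zeroLocus _, ?_⟩
  ext x
  rw [Set.mem_preimage, Set.mem_preimage, point_mem_zeroLocus_iff hJ, PrimeSpectrum.mem_zeroLocus]
  have h1 : ∀ g, g ∈ (MvPolynomial.pointToPoint x.coord : PrimeSpectrum (MvPolynomial ι ℂ)).asIdeal ↔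
      MvPolynomial.eval x.coord g = 0 := by
    intro g
    rw [← MvPolynomial.aeval_eq_eval]
    exact MvPolynomial.mem_vanishingIdeal_singleton_iff _ _
  exact ⟨fun h g hg => (h1 g).mp (h hg), fun h g hg => (h1 g).mpr (h g hg)⟩

theorem zeroLocus_anti {J J' : Ideal (MvPolynomial ι ℂ)} (h : J ≤ J') :
    Φ.zeroLocus J' ⊆ Φ.zeroLocus J :=
  Set.image_mono fun _ hx g hg => hx g (h hg)

theorem le_ideal_zeroLocus {J : Ideal (MvPolynomial ι ℂ)} (hJ : Φ.IsHomog J) :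
    J ≤ Φ.ideal (Φ.zeroLocus J) := fun g hg =>
  mem_ideal_iff.mpr fun _ hx => (point_mem_zeroLocus_iff hJ).mp hx g hg

theorem point_mem_zeroLocus_sup_span_iff {J : Ideal (MvPolynomial ι ℂ)} (hJ : Φ.IsHomog J)
    {γ : Φ.Cl} {s : MvPolynomial ι ℂ} (hs : s ∈ Φ.S γ) {x : Φ.CoxSpace} :
    Φ.point x ∈ Φ.zeroLocus (J ⊔ Ideal.span {s}) ↔
      Φ.point x ∈ Φ.zeroLocus J ∧ MvPolynomial.eval x.coord s = 0 := by
  rw [point_mem_zeroLocus_iff (hJ.sup (isHomog_span_singleton hs)), point_mem_zeroLocus_iff hJ]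
  constructor
  · exact fun h => ⟨fun g hg => h g (Ideal.mem_sup_left hg),
      h s (Ideal.mem_sup_right (Ideal.mem_span_singleton_self s))⟩
  · rintro ⟨h1, h2⟩ g hg
    obtain ⟨a, ha, b, hb, rfl⟩ := Submodule.mem_sup.mp hg
    obtain ⟨c, rfl⟩ := Ideal.mem_span_singleton.mp hb
    rw [map_add, map_mul, h1 a ha, h2, zero_mul, add_zero]

theorem eval_xHat_ne_zero_iff {σ : Finset ι} {x : ι → ℂ} :
    MvPolynomial.eval x (xHat σ) ≠ 0 ↔ ∀ ρ ∉ σ, x ρ ≠ 0 := by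
  simp [xHat, map_prod, Finset.prod_ne_zero_iff]

/-- Nullstellensatz: the factor `xHat σ` vanishes at all points outside the Cox space, about which
the hypothesis says nothing. -/
theorem exists_pow_mem_of_vanish {J : Ideal (MvPolynomial ι ℂ)} {s : MvPolynomial ι ℂ}
    (hs : ∀ x : Φ.CoxSpace, (∀ g ∈ J, MvPolynomial.eval x.coord g = 0) →
      MvPolynomial.eval x.coord s = 0) {σ : Finset ι} (hσ : σ ∈ Φ.cones) :
    ∃ N, (s * xHat σ) ^ N ∈ J := by
  have h : s * xHat σ ∈ J.radical := by
    rw [← MvPolynomial.vanishingIdeal_zeroLocus_eq_radical (K := ℂ)]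
    rw [MvPolynomial.mem_vanishingIdeal_iff]
    intro y hy
    rw [MvPolynomial.aeval_eq_eval, map_mul]
    by_cases hx : MvPolynomial.eval y (xHat σ) = 0
    · rw [hx, mul_zero]
    · rw [hs ⟨y, σ, hσ, eval_xHat_ne_zero_iff.mp hx⟩, zero_mul]
      intro g hg
      rw [← MvPolynomial.aeval_eq_eval]
      exact hy g hg
  exact h

/-! ### Cartier classes -/

theorem IsCartier.add {α β : Φ.Cl} (hα : Φ.IsCartier α) (hβ : Φ.IsCartier β) :
    Φ.IsCartier (α + β) := by
  obtain ⟨a, rfl, ha⟩ := hα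
  obtain ⟨b, rfl, hb⟩ := hβ
  refine ⟨a + b, Φ.cls_add a b, fun σ hσ => ?_⟩
  obtain ⟨m, hm⟩ := ha σ hσ
  obtain ⟨m', hm'⟩ := hb σ hσ
  exact ⟨m + m', fun ρ hρ => by rw [add_dotProduct, hm ρ hρ, hm' ρ hρ]; rfl⟩

theorem IsCartier.zsmul {α : Φ.Cl} (hα : Φ.IsCartier α) (k : ℤ) : Φ.IsCartier (k • α) := by
  obtain ⟨a, rfl, ha⟩ := hα
  refine ⟨k • a, Φ.cls_zsmul k a, fun σ hσ => ?_⟩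
  obtain ⟨m, hm⟩ := ha σ hσ
  exact ⟨k • m, fun ρ hρ => by rw [smul_dotProduct, hm ρ hρ]; rfl⟩

theorem IsCartier.nsmul {α : Φ.Cl} (hα : Φ.IsCartier α) (k : ℕ) : Φ.IsCartier (k • α) := by
  rw [← natCast_zsmul]
  exact hα.zsmul k

theorem IsCartier.neg {α : Φ.Cl} (hα : Φ.IsCartier α) : Φ.IsCartier (-α) := by
  simpa using hα.zsmul (-1)

theorem IsCartier.sub {α β : Φ.Cl} (hα : Φ.IsCartier α) (hβ : Φ.IsCartier β) :
    Φ.IsCartier (α - β) := by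
  rw [sub_eq_add_neg]
  exact hα.add hβ.neg

variable (Φ) in
theorem isCartier_zero : Φ.IsCartier 0 := ⟨0, Φ.cls_eq_mkQ 0 ▸ map_zero _, fun _ _ => ⟨0, by simp⟩⟩

theorem IsCartier.exists_cls_eq {α : Φ.Cl} (hα : Φ.IsCartier α) {σ : Finset ι} (hσ : σ ∈ Φ.cones) :
    ∃ e : ι → ℤ, Φ.cls e = α ∧ ∀ ρ ∈ σ, e ρ = 0 := by
  obtain ⟨a, rfl, ha⟩ := hα
  obtain ⟨m, hm⟩ := ha σ hσ
  refine ⟨a - Φ.divChar m, by rw [cls_sub, cls_divChar, sub_zero], fun ρ hρ => ?_⟩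
  rw [Pi.sub_apply, divChar_apply, hm ρ hρ, sub_self]

/-! ### Sections of ample classes -/

theorem IsAmple.exists_section {η : Φ.Cl} (hη : Φ.IsAmple η) {Z : Set Φ.Variety} (hZ : IsClosed Z)
    {x : Φ.CoxSpace} (hx : Φ.point x ∉ Z) :
    ∃ d : ℕ, 1 ≤ d ∧ ∃ s ∈ Φ.S (d • η), MvPolynomial.eval x.coord s ≠ 0 ∧ s ∈ Φ.ideal Z := by
  obtain ⟨d, hd, s, hs, ⟨y, hy, hyx⟩, hsub⟩ := hη.2 Zᶜ hZ.isOpen_compl (Φ.point x) hx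
  refine ⟨d, hd, s, hs, fun h => hy (eval_eq_zero_of_point_eq hs hyx.symm h), ?_⟩
  rw [mem_ideal_iff]
  intro z hz
  by_contra h
  exact hsub ⟨z, h, rfl⟩ hz

theorem IsAmple.zeroLocus_ideal {η : Φ.Cl} (hη : Φ.IsAmple η) {Z : Set Φ.Variety}
    (hZ : IsClosed Z) : Φ.zeroLocus (Φ.ideal Z) = Z := by
  ext p
  obtain ⟨x, rfl⟩ := exists_point_eq p
  rw [point_mem_zeroLocus_iff (isHomog_ideal Z)]
  constructor
  · intro h
    by_contra hx
    obtain ⟨d, -, s, -, hs, hs'⟩ := hη.exists_section hZ hx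
    exact hs (h s hs')
  · exact fun h g hg => mem_ideal_iff.mp hg x h

theorem X_dvd_of_vanish (ρ : ι) {s : MvPolynomial ι ℂ}
    (hs : ∀ x : ι → ℂ, x ρ = 0 → (∀ ρ' ≠ ρ, x ρ' ≠ 0) → MvPolynomial.eval x s = 0) :
    MvPolynomial.X ρ ∣ s := by
  have hp : (Ideal.span {(MvPolynomial.X ρ : MvPolynomial ι ℂ)}).IsPrime :=
    (Ideal.span_singleton_prime (MvPolynomial.X_ne_zero ρ)).mpr (MvPolynomial.X_prime (R := ℂ) (i := ρ))
  have h : s * xHat {ρ} ∈ Ideal.span {(MvPolynomial.X ρ : MvPolynomial ι ℂ)} := by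
    rw [← hp.radical, ← MvPolynomial.vanishingIdeal_zeroLocus_eq_radical (K := ℂ),
      MvPolynomial.mem_vanishingIdeal_iff]
    intro y hy
    have hy0 : y ρ = 0 := by simpa using hy _ (Ideal.mem_span_singleton_self _)
    rw [MvPolynomial.aeval_eq_eval, map_mul]
    by_cases hx : MvPolynomial.eval y (xHat {ρ}) = 0
    · rw [hx, mul_zero]
    · rw [hs y hy0, zero_mul]
      intro ρ' hρ'
      exact eval_xHat_ne_zero_iff.mp hx ρ' (by simpa using hρ')
  rcases hp.mem_or_mem h with h | h
  · exact Ideal.mem_span_singleton.mp h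
  · exfalso
    rw [Ideal.mem_span_singleton, xHat, (MvPolynomial.X_prime (R := ℂ) (i := ρ)).dvd_finsetProd_iff] at h
    obtain ⟨ρ', hρ', hd⟩ := h
    rw [MvPolynomial.X_dvd_X] at hd
    simp at hρ'
    exact hρ' hd.symm

/-- Ampleness is applied at the distinguished point of the orbit of σ, giving a section nonzero
there and zero outside U_σ. A monomial of it that is nonzero at this point avoids the variables of
σ. The section vanishes on every D_ρ with ρ ∉ σ, hence is divisible by those X_ρ. -/
theorem IsAmple.exists_mdeg_eq_nsmul {η : Φ.Cl} (hη : Φ.IsAmple η) {σ : Finset ι}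
    (hσ : σ ∈ Φ.cones) : ∃ d : ℕ, 1 ≤ d ∧ ∃ b : ι →₀ ℕ, Φ.mdeg b = d • η ∧ (∀ ρ ∈ σ, b ρ = 0) ∧
      ∀ ρ ∉ σ, 1 ≤ b ρ := by
  let x : Φ.CoxSpace := ⟨fun ρ => if ρ ∈ σ then 0 else 1, σ, hσ, fun ρ hρ => by simp [hρ]⟩
  have hx : ∀ ρ ∈ σ, x.coord ρ = 0 := fun ρ hρ => if_pos hρ
  have hhom : Φ.IsHomog (Ideal.span {xHat σ}) := isHomog_span_singleton (xHat_mem_S σ)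
  obtain ⟨d, hd, s, hs, hsx, hsI⟩ := hη.exists_section (isClosed_zeroLocus hhom) (x := x) (by
    rw [point_mem_zeroLocus_iff hhom]
    intro h
    refine eval_xHat_ne_zero_iff.mpr (fun ρ hρ => ?_) (h _ (Ideal.mem_span_singleton_self _))
    simp [x, hρ])
  refine ⟨d, hd, ?_⟩
  rw [MvPolynomial.eval_eq'] at hsx
  obtain ⟨b, hb, hb'⟩ := Finset.exists_ne_zero_of_sum_ne_zero hsx
  have hb0 := MvPolynomial.mem_support_iff.mp hb
  refine ⟨b, mem_S_iff.mp hs b hb0, fun ρ hρ => ?_, fun ρ hρ => ?_⟩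
  · by_contra h
    refine hb' ?_
    rw [Finset.prod_eq_zero (Finset.mem_univ ρ) (by rw [hx ρ hρ, zero_pow h]), mul_zero]
  · have hdvd : MvPolynomial.X ρ ∣ s := by
      refine X_dvd_of_vanish ρ fun y hy hy' => ?_
      let z : Φ.CoxSpace := ⟨y, {ρ}, Φ.ray_mem ρ, fun ρ' h => hy' ρ' (by simpa using h)⟩
      refine mem_ideal_iff.mp hsI z ((point_mem_zeroLocus_iff hhom).mpr fun g hg => ?_)
      obtain ⟨c, rfl⟩ := Ideal.mem_span_singleton.mp hg
      rw [map_mul]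
      have : MvPolynomial.eval z.coord (xHat σ) = 0 := by
        by_contra h
        exact eval_xHat_ne_zero_iff.mp h ρ hρ hy
      rw [this, zero_mul]
    by_contra! h
    obtain ⟨c, rfl⟩ := hdvd
    rw [MvPolynomial.coeff_X_mul', if_neg (by simpa using h)] at hb0
    exact hb0 rfl

/-- Write m = d(m/d) + m % d. The Cartier classes η and α have representatives vanishing on σ, and
off σ the multiple m/d of the positive exponent from `IsAmple.exists_mdeg_eq_nsmul` outweighs the
bounded remainder. -/
theorem IsAmple.eventually_exists_mdeg_eq {η : Φ.Cl} (hη : Φ.IsAmple η) {α : Φ.Cl}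
    (hα : Φ.IsCartier α) {σ : Finset ι} (hσ : σ ∈ Φ.cones) :
    ∀ᶠ m : ℕ in atTop, ∃ b : ι →₀ ℕ, Φ.mdeg b = m • η + α ∧ (∀ ρ ∈ σ, b ρ = 0) ∧
      ∀ ρ ∉ σ, 1 ≤ b ρ := by
  obtain ⟨d, hd, a, ha, ha0, ha1⟩ := hη.exists_mdeg_eq_nsmul hσ
  obtain ⟨h, hh, hh0⟩ := hη.1.exists_cls_eq hσ
  obtain ⟨e, he, he0⟩ := hα.exists_cls_eq hσ
  obtain ⟨K, hK⟩ : ∃ K : ℕ, ∀ ρ, (d : ℤ) * |h ρ| + |e ρ| + 1 ≤ K := by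
    refine ⟨∑ ρ, ((d : ℤ) * |h ρ| + |e ρ| + 1).toNat, fun ρ => ?_⟩
    have := Finset.single_le_sum (f := fun ρ => ((d : ℤ) * |h ρ| + |e ρ| + 1).toNat)
      (fun _ _ => Nat.zero_le _) (Finset.mem_univ ρ)
    exact (Int.self_le_toNat _).trans (by exact_mod_cast this)
  filter_upwards [eventually_ge_atTop (d * K)] with m hm
  have hq : K ≤ m / d := (Nat.le_div_iff_mul_le hd).mpr (by rwa [mul_comm])
  set v : ι → ℤ := (m / d) • (fun ρ => (a ρ : ℤ)) + (m % d) • h + e with hv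
  have hv0 : ∀ ρ ∈ σ, v ρ = 0 := fun ρ hρ => by simp [hv, ha0 ρ hρ, hh0 ρ hρ, he0 ρ hρ]
  have hv1 : ∀ ρ ∉ σ, 1 ≤ v ρ := by
    intro ρ hρ
    have h1 : (1 : ℤ) ≤ a ρ := by exact_mod_cast ha1 ρ hρ
    have h2 : (K : ℤ) ≤ ((m / d : ℕ) : ℤ) := by exact_mod_cast hq
    have h3 : ((m % d : ℕ) : ℤ) ≤ d := by exact_mod_cast (Nat.mod_lt m hd).le
    have h4 : -|e ρ| ≤ e ρ := neg_abs_le _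
    have h5 : -((d : ℤ) * |h ρ|) ≤ ((m % d : ℕ) : ℤ) * h ρ := by
      have := mul_le_mul_of_nonneg_right h3 (abs_nonneg (h ρ))
      have h6 : -(((m % d : ℕ) : ℤ) * |h ρ|) ≤ ((m % d : ℕ) : ℤ) * h ρ := by
        have := mul_le_mul_of_nonneg_left (neg_abs_le (h ρ)) (Int.natCast_nonneg (m % d))
        linarith
      linarith
    have h7 : ((m / d : ℕ) : ℤ) ≤ ((m / d : ℕ) : ℤ) * a ρ :=
      le_mul_of_one_le_right (Int.natCast_nonneg _) h1
    have h8 := hK ρ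
    have : v ρ = ((m / d : ℕ) : ℤ) * a ρ + ((m % d : ℕ) : ℤ) * h ρ + e ρ := by
      simp [hv, nsmul_eq_mul]
    linarith
  have hvn : ∀ ρ, 0 ≤ v ρ := fun ρ => by
    by_cases hρ : ρ ∈ σ
    · rw [hv0 ρ hρ]
    · exact zero_le_one.trans (hv1 ρ hρ)
  refine ⟨Finsupp.equivFunOnFinite.symm fun ρ => (v ρ).toNat, ?_, fun ρ hρ => ?_, fun ρ hρ => ?_⟩
  · have : (fun ρ => ((Finsupp.equivFunOnFinite.symm fun ρ => (v ρ).toNat : ι →₀ ℕ) ρ : ℤ)) = v := by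
      ext ρ
      simp [hvn ρ]
    rw [mdeg, this, hv, cls_add, cls_add, cls_nsmul, cls_nsmul, hh, he]
    change (m / d) • Φ.mdeg a + (m % d) • η + α = _
    rw [ha, smul_smul, ← add_smul, Nat.div_add_mod']
  · simp [hv0 ρ hρ]
  · have := hv1 ρ hρ
    simp
    omega

/-- This is strict convexity of the support function of η, made quantitative. Let T be the set of
rays with exponent below M, and σ a cone containing Σ_T v_ρ. If T ⊄ σ, the character comparing d·b
with m·a pairs with Σ_T v_ρ to at most a constant minus m. As a vanishes on σ, the pairing is also
bounded below independently of m, which is absurd for large m. -/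
theorem IsAmple.eventually_forall_mdeg {η : Φ.Cl} (hη : Φ.IsAmple η) (δ : Φ.Cl) (M : ℕ) :
    ∀ᶠ m : ℕ in atTop, ∀ b : ι →₀ ℕ, Φ.mdeg b = m • η + δ → ∃ σ ∈ Φ.cones, ∀ ρ ∉ σ, M ≤ b ρ := by
  obtain ⟨e, he⟩ := Φ.exists_cls_eq δ
  have key : ∀ T : Finset ι, ∀ᶠ m : ℕ in atTop, ∀ b : ι →₀ ℕ, Φ.mdeg b = m • η + δ →
      (∀ ρ ∈ T, b ρ < M) → ∃ σ ∈ Φ.cones, T ⊆ σ := by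
    intro T
    obtain ⟨σ, hσ, l, hl, hu⟩ := Φ.exists_nonneg_combination (∑ ρ ∈ T, Φ.gen ρ)
    obtain ⟨d, hd, a, ha, ha0, ha1⟩ := hη.exists_mdeg_eq_nsmul hσ
    obtain ⟨C, hC⟩ := exists_nat_gt (∑ ρ ∈ T, ((d : ℝ) * M + d * |(e ρ : ℝ)|) +
      ∑ ρ ∈ σ, l ρ * (d * |(e ρ : ℝ)|))
    filter_upwards [eventually_ge_atTop C] with m hm b hb hbT
    refine ⟨σ, hσ, ?_⟩
    by_contra hsub
    obtain ⟨ρ₀, hρ₀, hρ₀'⟩ := Finset.not_subset.mp hsub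
    have h1 : Φ.cls (d • fun ρ => (b ρ : ℤ)) = Φ.cls (m • (fun ρ => (a ρ : ℤ)) + d • e) := by
      rw [cls_nsmul, cls_add, cls_nsmul, cls_nsmul, he]
      change d • Φ.mdeg b = m • Φ.mdeg a + d • δ
      rw [hb, ha, smul_add, smul_comm]
    obtain ⟨u, hu'⟩ := Φ.cls_eq_cls_iff.mp h1
    have h2 : ∀ ρ, ((u ⬝ᵥ Φ.gen ρ : ℤ) : ℝ) = d * b ρ - m * a ρ - d * e ρ := by
      intro ρ
      have h3 : (d * b ρ : ℤ) = m * a ρ + d * e ρ + u ⬝ᵥ Φ.gen ρ := by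
        simpa [nsmul_eq_mul, divChar_apply] using congrFun hu' ρ
      have : ((d * b ρ : ℤ) : ℝ) = ((m * a ρ + d * e ρ + u ⬝ᵥ Φ.gen ρ : ℤ) : ℝ) := by rw [h3]
      push_cast at this
      linarith
    have h3 := hu u
    rw [dotProduct_sum, Int.cast_sum] at h3
    have h4 : ∑ ρ ∈ T, ((u ⬝ᵥ Φ.gen ρ : ℤ) : ℝ) ≤
        ∑ ρ ∈ T, ((d : ℝ) * M + d * |(e ρ : ℝ)|) - m := by
      have h5 : (m : ℝ) ≤ ∑ ρ ∈ T, (m : ℝ) * a ρ := by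
        have h6 : (m : ℝ) * a ρ₀ ≤ ∑ ρ ∈ T, (m : ℝ) * a ρ :=
          Finset.single_le_sum (f := fun ρ => (m : ℝ) * a ρ) (fun _ _ => by positivity) hρ₀
        have h7 : (1 : ℝ) ≤ a ρ₀ := by exact_mod_cast ha1 ρ₀ hρ₀'
        have h8 : (0 : ℝ) ≤ m := by positivity
        nlinarith
      have h6 : ∑ ρ ∈ T, ((u ⬝ᵥ Φ.gen ρ : ℤ) : ℝ) ≤
          ∑ ρ ∈ T, (((d : ℝ) * M + d * |(e ρ : ℝ)|) - m * a ρ) := by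
        refine Finset.sum_le_sum fun ρ hρ => ?_
        rw [h2]
        have h7 : (b ρ : ℝ) ≤ M := by exact_mod_cast (hbT ρ hρ).le
        have h8 : (0 : ℝ) ≤ d := by positivity
        have h9 := neg_abs_le (e ρ : ℝ)
        nlinarith
      rw [Finset.sum_sub_distrib] at h6
      linarith
    have h5 : -∑ ρ ∈ σ, l ρ * (d * |(e ρ : ℝ)|) ≤ ∑ ρ ∈ σ, l ρ * ((u ⬝ᵥ Φ.gen ρ : ℤ) : ℝ) := by
      rw [← Finset.sum_neg_distrib]
      refine Finset.sum_le_sum fun ρ hρ => ?_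
      rw [h2, ha0 ρ hρ, ← mul_neg]
      refine mul_le_mul_of_nonneg_left ?_ (hl ρ)
      have h8 : (0 : ℝ) ≤ d := by positivity
      have h9 := le_abs_self (e ρ : ℝ)
      have h10 : (0 : ℝ) ≤ d * b ρ := by positivity
      have h11 := mul_le_mul_of_nonneg_left h9 h8
      push_cast
      linarith
    have h6 : (C : ℝ) ≤ m := by exact_mod_cast hm
    linarith
  filter_upwards [eventually_all.mpr key] with m hm b hb
  obtain ⟨σ, hσ, hT⟩ := hm (Finset.univ.filter fun ρ => b ρ < M) b hb (by simp)
  refine ⟨σ, hσ, fun ρ hρ => ?_⟩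
  by_contra! h
  exact hρ (hT (by simpa using h))

/-! ### Sections of large multiples of an ample class -/

theorem eval_monomial_ne_zero {b : ι →₀ ℕ} {x : ι → ℂ} {σ : Finset ι} (hx : ∀ ρ ∉ σ, x ρ ≠ 0)
    (hb : ∀ ρ ∈ σ, b ρ = 0) : MvPolynomial.eval x (MvPolynomial.monomial b (1 : ℂ)) ≠ 0 := by
  rw [MvPolynomial.eval_monomial, one_mul, Finsupp.prod_fintype _ _ (by simp),
    Finset.prod_ne_zero_iff]
  intro ρ _
  by_cases hρ : ρ ∈ σ
  · rw [hb ρ hρ, pow_zero]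
    exact one_ne_zero
  · exact pow_ne_zero _ (hx ρ hρ)

theorem xHat_pow_dvd_monomial {b : ι →₀ ℕ} {σ : Finset ι} {M : ℕ} (hb : ∀ ρ ∉ σ, M ≤ b ρ) (c : ℂ) :
    xHat σ ^ M ∣ MvPolynomial.monomial b c := by
  rw [xHat_eq_monomial, MvPolynomial.monomial_pow, one_pow]
  refine (MvPolynomial.monomial_dvd_monomial).mpr ⟨Or.inr fun ρ => ?_, one_dvd _⟩
  by_cases hρ : ρ ∈ σ
  · simp [Finsupp.single_apply, hρ]
  · simpa [Finsupp.single_apply, hρ] using hb ρ hρ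

theorem IsAmple.eventually_exists_section {η : Φ.Cl} (hη : Φ.IsAmple η) {α : Φ.Cl}
    (hα : Φ.IsCartier α) {σ : Finset ι} (hσ : σ ∈ Φ.cones) :
    ∀ᶠ m : ℕ in atTop, ∃ s ∈ Φ.S (m • η + α), xHat σ ∣ s ∧
      ∀ x : ι → ℂ, (∀ ρ ∉ σ, x ρ ≠ 0) → MvPolynomial.eval x s ≠ 0 := by
  filter_upwards [hη.eventually_exists_mdeg_eq hα hσ] with m hm
  obtain ⟨b, hb, hb0, hb1⟩ := hm
  refine ⟨MvPolynomial.monomial b 1, hb ▸ monomial_mem_S b 1, ?_, fun x hx =>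
    eval_monomial_ne_zero hx hb0⟩
  simpa using xHat_pow_dvd_monomial hb1 1

theorem IsAmple.eventually_exists_eval_ne_zero {η : Φ.Cl} (hη : Φ.IsAmple η) {α : Φ.Cl}
    (hα : Φ.IsCartier α) (x : Φ.CoxSpace) :
    ∀ᶠ m : ℕ in atTop, ∃ s ∈ Φ.S (m • η + α), MvPolynomial.eval x.coord s ≠ 0 := by
  obtain ⟨σ, hσ, hx⟩ := x.mem
  filter_upwards [hη.eventually_exists_section hα hσ] with m hm
  obtain ⟨s, hs, -, h⟩ := hm
  exact ⟨s, hs, h _ hx⟩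

/-- If s is a section of mη as in the definition of ampleness at p, and t a section of dη + α − η
nonzero at p, then s·t^m is a section of m(dη + α) that serves at p. Since there are finitely many
cones, d is uniform. -/
theorem IsAmple.eventually_isAmple {η : Φ.Cl} (hη : Φ.IsAmple η) {α : Φ.Cl}
    (hα : Φ.IsCartier α) : ∀ᶠ d : ℕ in atTop, Φ.IsAmple (d • η + α) := by
  have h1 : ∀ σ : Finset ι, ∀ᶠ d : ℕ in atTop, σ ∈ Φ.cones →
      ∃ s ∈ Φ.S (d • η + (α - η)), xHat σ ∣ s ∧
      ∀ x : ι → ℂ, (∀ ρ ∉ σ, x ρ ≠ 0) → MvPolynomial.eval x s ≠ 0 := by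
    intro σ
    by_cases hσ : σ ∈ Φ.cones
    · filter_upwards [hη.eventually_exists_section (hα.sub hη.1) hσ] with d hd _ using hd
    · exact Eventually.of_forall fun d h => absurd h hσ
  filter_upwards [eventually_all.mpr h1] with d hd
  refine ⟨(hη.1.nsmul d).add hα, fun U hU p hp => ?_⟩
  obtain ⟨m, hm, s, hs, ⟨x, hx, hxp⟩, hsU⟩ := hη.2 U hU p hp
  obtain ⟨σ, hσ, hxσ⟩ := x.mem
  obtain ⟨t, ht, -, htx⟩ := hd σ hσ
  refine ⟨m, hm, s * t ^ m, ?_, ⟨x, ?_, hxp⟩, ?_⟩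
  · have := mul_mem_S hs (pow_mem_S ht m)
    rwa [← smul_add, show η + (d • η + (α - η)) = d • η + α by abel] at this
  · simpa [map_mul, map_pow] using ⟨hx, fun h => absurd h (htx _ hxσ)⟩
  · rintro _ ⟨y, hy, rfl⟩
    refine hsU ⟨y, fun h => hy ?_, rfl⟩
    rw [map_mul, h, zero_mul]

/-- Each monomial of large degree is divisible by a high power of some `xHat σ`, and that power
already carries g into J. -/
theorem IsAmple.eventually_mul_mem {η : Φ.Cl} (hη : Φ.IsAmple η) (δ : Φ.Cl)
    {J : Ideal (MvPolynomial ι ℂ)} {g : MvPolynomial ι ℂ}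
    (h : ∀ σ ∈ Φ.cones, ∃ M, xHat σ ^ M * g ∈ J) :
    ∀ᶠ m : ℕ in atTop, ∀ u ∈ Φ.S (m • η + δ), u * g ∈ J := by
  choose! M hM using h
  filter_upwards [hη.eventually_forall_mdeg δ (∑ σ, M σ)] with m hm u hu
  rw [u.as_sum, Finset.sum_mul]
  refine J.sum_mem fun b hb => ?_
  obtain ⟨σ, hσ, hb'⟩ := hm b (mem_S_iff.mp hu b (MvPolynomial.mem_support_iff.mp hb))
  obtain ⟨c, hc⟩ := xHat_pow_dvd_monomial (M := M σ) (fun ρ hρ =>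
    (Finset.single_le_sum (f := M) (fun _ _ => Nat.zero_le _) (Finset.mem_univ σ)).trans (hb' ρ hρ))
    (MvPolynomial.coeff b u)
  rw [hc, mul_assoc, mul_left_comm]
  exact J.mul_mem_left _ (hM σ hσ)

theorem IsAmple.eventually_mem_of_zeroLocus_eq_empty {η : Φ.Cl} (hη : Φ.IsAmple η) (δ : Φ.Cl)
    {J : Ideal (MvPolynomial ι ℂ)} (h : Φ.zeroLocus J = ∅) :
    ∀ᶠ m : ℕ in atTop, ∀ g ∈ Φ.S (m • η + δ), g ∈ J := by
  have h1 : ∀ σ ∈ Φ.cones, ∃ M, xHat σ ^ M * 1 ∈ J := by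
    intro σ hσ
    obtain ⟨N, hN⟩ := exists_pow_mem_of_vanish (Φ := Φ) (J := J) (s := 1) (fun x hx => by
      have : Φ.point x ∈ Φ.zeroLocus J := ⟨x, hx, rfl⟩
      simp [h] at this) hσ
    exact ⟨N, by simpa using hN⟩
  filter_upwards [hη.eventually_mul_mem δ h1] with m hm g hg
  simpa using hm g hg

theorem IsAmple.eventually_hilb_eq_zero {η : Φ.Cl} (hη : Φ.IsAmple η) (δ : Φ.Cl)
    {J : Ideal (MvPolynomial ι ℂ)} (h : Φ.zeroLocus J = ∅) :
    ∀ᶠ m : ℕ in atTop, Φ.hilb J (m • η + δ) = 0 := by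
  filter_upwards [hη.eventually_mem_of_zeroLocus_eq_empty δ h] with m hm using hilb_eq_zero hm

/-! ### Dévissage -/

variable (Φ) in
/-- Homogeneous elements of Cartier degree are in `J` or are nonzerodivisors modulo `J`. -/
def PrimeLike (J : Ideal (MvPolynomial ι ℂ)) : Prop :=
  ∀ γ, Φ.IsCartier γ → ∀ s ∈ Φ.S γ, s ∉ J → J.colonElem s ≤ J

-- Noetherian induction: if J is not `PrimeLike`, a witness s makes both J : s and J + (s) strictly
-- larger. Restricting s to Cartier degrees γ keeps the twists α − γ in `hilb_eq_add'` Cartier.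
@[elab_as_elim]
theorem devissage {Pr : Ideal (MvPolynomial ι ℂ) → Prop}
    (split : ∀ J, Φ.IsHomog J → ∀ γ, Φ.IsCartier γ → ∀ s ∈ Φ.S γ, Pr (J.colonElem s) →
      Pr (J ⊔ Ideal.span {s}) → Pr J)
    (prime : ∀ J, Φ.IsHomog J → Φ.PrimeLike J → (∀ J', J < J' → Φ.IsHomog J' → Pr J') → Pr J)
    {J : Ideal (MvPolynomial ι ℂ)} (hJ : Φ.IsHomog J) : Pr J := by
  induction J using WellFoundedGT.induction with
  | ind J ih =>
    by_cases h : Φ.PrimeLike J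
    · exact prime J hJ h fun J' hlt hJ' => ih J' hlt hJ'
    · unfold PrimeLike at h
      push Not at h
      obtain ⟨γ, hγ, s, hs, hsJ, hc⟩ := h
      refine split J hJ γ hγ s hs (ih _ ?_ (hJ.colonElem hs)) (ih _ ?_ (hJ.sup (isHomog_span_singleton hs)))
      · exact lt_of_le_not_ge (J.le_colonElem s) hc
      · refine lt_of_le_not_ge le_sup_left fun hle => hsJ (hle ?_)
        exact Ideal.mem_sup_right (Ideal.mem_span_singleton_self s)

theorem zeroLocus_colonElem_subset (J : Ideal (MvPolynomial ι ℂ)) (s : MvPolynomial ι ℂ) :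
    Φ.zeroLocus (J.colonElem s) ⊆ Φ.zeroLocus J := zeroLocus_anti (J.le_colonElem s)

theorem zeroLocus_sup_subset (J K : Ideal (MvPolynomial ι ℂ)) :
    Φ.zeroLocus (J ⊔ K) ⊆ Φ.zeroLocus J := zeroLocus_anti le_sup_left

theorem hilb_eq_add' {J : Ideal (MvPolynomial ι ℂ)} (hJ : Φ.IsHomog J) {γ : Φ.Cl}
    {s : MvPolynomial ι ℂ} (hs : s ∈ Φ.S γ) (α : Φ.Cl) :
    Φ.hilb J α = Φ.hilb (J.colonElem s) (α - γ) + Φ.hilb (J ⊔ Ideal.span {s}) α := by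
  have := hilb_eq_add hJ hs (α - γ)
  rwa [add_sub_cancel] at this

section PrimeLike

variable {J : Ideal (MvPolynomial ι ℂ)}

theorem notMem_of_eval_ne_zero (hJ : Φ.IsHomog J) {x : Φ.CoxSpace}
    (hx : Φ.point x ∈ Φ.zeroLocus J) {s : MvPolynomial ι ℂ}
    (h : MvPolynomial.eval x.coord s ≠ 0) : s ∉ J :=
  fun hs => h ((point_mem_zeroLocus_iff hJ).mp hx s hs)

theorem PrimeLike.mem_of_pow_mem (hP : Φ.PrimeLike J) {γ : Φ.Cl} (hγ : Φ.IsCartier γ)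
    {s : MvPolynomial ι ℂ} (hs : s ∈ Φ.S γ) {N : ℕ} (h : s ^ N ∈ J) (h1 : (1 : MvPolynomial ι ℂ) ∉ J) :
    s ∈ J := by
  by_contra hsJ
  induction N with
  | zero => exact h1 (by simpa using h)
  | succ N ih => exact ih (hP γ hγ s hs hsJ (by rwa [Ideal.mem_colonElem, ← pow_succ']))

/-- By the Nullstellensatz a power of s·x̂_σ lies in J. As x̂_σ need not have Cartier degree, it is
replaced by a multiple t of Cartier degree that is nonzero at a point of V(J); `PrimeLike` then
removes the power and the factor t. -/
theorem PrimeLike.mem_of_vanish (hP : Φ.PrimeLike J) (hJ : Φ.IsHomog J) {η : Φ.Cl}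
    (hη : Φ.IsAmple η) (hne : (Φ.zeroLocus J).Nonempty) {γ : Φ.Cl} (hγ : Φ.IsCartier γ)
    {s : MvPolynomial ι ℂ} (hs : s ∈ Φ.S γ) (hv : s ∈ Φ.ideal (Φ.zeroLocus J)) : s ∈ J := by
  obtain ⟨p, hp⟩ := hne
  obtain ⟨x, rfl⟩ := exists_point_eq p
  obtain ⟨σ, hσ, hxσ⟩ := x.mem
  obtain ⟨m, t, ht, ⟨r, rfl⟩, htx⟩ := (hη.eventually_exists_section Φ.isCartier_zero hσ).exists
  obtain ⟨N, hN⟩ := exists_pow_mem_of_vanish (Φ := Φ) (J := J) (s := s)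
    (fun y hy => mem_ideal_iff.mp hv y ⟨y, hy, rfl⟩) hσ
  have h1 : (1 : MvPolynomial ι ℂ) ∉ J := notMem_of_eval_ne_zero hJ hp (by simp)
  have ht' : xHat σ * r ∉ J := notMem_of_eval_ne_zero hJ hp (htx _ hxσ)
  have hγ' : Φ.IsCartier (m • η + 0) := (hη.1.nsmul m).add Φ.isCartier_zero
  have h2 : xHat σ * r * s ∈ J := by
    refine hP.mem_of_pow_mem (hγ'.add hγ) (mul_mem_S ht hs) (N := N) ?_ h1
    rw [show xHat σ * r * s = s * xHat σ * r by ring, mul_pow]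
    exact J.mul_mem_right _ hN
  exact hP _ hγ' _ ht ht' h2

theorem PrimeLike.isPreirreducible (hP : Φ.PrimeLike J) (hJ : Φ.IsHomog J) {η : Φ.Cl}
    (hη : Φ.IsAmple η) : IsPreirreducible (Φ.zeroLocus J) := by
  rw [isPreirreducible_iff_isClosed_union_isClosed]
  intro Z₁ Z₂ h₁ h₂ hsub
  by_contra! h
  obtain ⟨p₁, hp₁, hn₁⟩ := Set.not_subset.mp h.1
  obtain ⟨p₂, hp₂, hn₂⟩ := Set.not_subset.mp h.2
  obtain ⟨x₁, rfl⟩ := exists_point_eq p₁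
  obtain ⟨x₂, rfl⟩ := exists_point_eq p₂
  obtain ⟨d₁, -, s₁, hs₁, he₁, hv₁⟩ := hη.exists_section h₁ hn₁
  obtain ⟨d₂, -, s₂, hs₂, he₂, hv₂⟩ := hη.exists_section h₂ hn₂
  have hm : s₁ * s₂ ∈ J := by
    refine hP.mem_of_vanish hJ hη ⟨_, hp₁⟩ ((hη.1.nsmul d₁).add (hη.1.nsmul d₂))
      (mul_mem_S hs₁ hs₂) (mem_ideal_iff.mpr fun y hy => ?_)
    rw [map_mul]
    rcases hsub hy with hy | hy
    · rw [mem_ideal_iff.mp hv₁ y hy, zero_mul]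
    · rw [mem_ideal_iff.mp hv₂ y hy, mul_zero]
  exact notMem_of_eval_ne_zero hJ hp₂ he₂
    (hP _ (hη.1.nsmul d₁) s₁ hs₁ (notMem_of_eval_ne_zero hJ hp₁ he₁) hm)

variable {x : Φ.CoxSpace} {γ : Φ.Cl} {s : MvPolynomial ι ℂ}

theorem PrimeLike.hilb_add (hP : Φ.PrimeLike J) (hJ : Φ.IsHomog J)
    (hx : Φ.point x ∈ Φ.zeroLocus J) (hγ : Φ.IsCartier γ) (hs : s ∈ Φ.S γ)
    (hsx : MvPolynomial.eval x.coord s ≠ 0) (δ : Φ.Cl) :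
    Φ.hilb J (γ + δ) = Φ.hilb J δ + Φ.hilb (J ⊔ Ideal.span {s}) (γ + δ) := by
  have h := hilb_eq_add hJ hs δ
  rwa [le_antisymm (hP γ hγ s hs (notMem_of_eval_ne_zero hJ hx hsx)) (J.le_colonElem s)] at h

theorem lt_sup_span (hJ : Φ.IsHomog J) (hx : Φ.point x ∈ Φ.zeroLocus J)
    (hsx : MvPolynomial.eval x.coord s ≠ 0) : J < J ⊔ Ideal.span {s} :=
  lt_of_le_not_ge le_sup_left fun h => notMem_of_eval_ne_zero hJ hx hsx
    (h (Ideal.mem_sup_right (Ideal.mem_span_singleton_self s)))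

theorem zeroLocus_sup_span_ssubset (hJ : Φ.IsHomog J) (hx : Φ.point x ∈ Φ.zeroLocus J)
    (hs : s ∈ Φ.S γ) (hsx : MvPolynomial.eval x.coord s ≠ 0) :
    Φ.zeroLocus (J ⊔ Ideal.span {s}) ⊂ Φ.zeroLocus J :=
  ⟨zeroLocus_sup_subset _ _, fun h => hsx ((point_mem_zeroLocus_sup_span_iff hJ hs).mp (h hx)).2⟩

theorem PrimeLike.topologicalKrullDim_le (hP : Φ.PrimeLike J) (hJ : Φ.IsHomog J) {η : Φ.Cl}
    (hη : Φ.IsAmple η) (hx : Φ.point x ∈ Φ.zeroLocus J)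
    (hs : s ∈ Φ.S γ) (hsx : MvPolynomial.eval x.coord s ≠ 0) {k : ℕ}
    (h : topologicalKrullDim (Φ.zeroLocus J) ≤ (k + 1 : ℕ)) :
    topologicalKrullDim (Φ.zeroLocus (J ⊔ Ideal.span {s})) ≤ k :=
  topologicalKrullDim_le_of_ssubset (isClosed_zeroLocus (hJ.sup (isHomog_span_singleton hs)))
    (isClosed_zeroLocus hJ) ⟨⟨_, hx⟩, hP.isPreirreducible hJ hη⟩
    (zeroLocus_sup_span_ssubset hJ hx hs hsx) h

theorem PrimeLike.zeroLocus_eq_empty (hP : Φ.PrimeLike J) (hJ : Φ.IsHomog J) {η : Φ.Cl}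
    (hη : Φ.IsAmple η) (hx : Φ.point x ∈ Φ.zeroLocus J)
    (hs : s ∈ Φ.S γ) (hsx : MvPolynomial.eval x.coord s ≠ 0)
    (h : topologicalKrullDim (Φ.zeroLocus J) ≤ (0 : ℕ)) :
    Φ.zeroLocus (J ⊔ Ideal.span {s}) = ∅ :=
  eq_empty_of_ssubset_of_topologicalKrullDim_le_zero
    (isClosed_zeroLocus (hJ.sup (isHomog_span_singleton hs)))
    (isClosed_zeroLocus hJ) ⟨⟨_, hx⟩, hP.isPreirreducible hJ hη⟩
    (zeroLocus_sup_span_ssubset hJ hx hs hsx) h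

end PrimeLike

/-! ### Hilbert polynomials -/

/-- For `PrimeLike` J, a section s nonzero at a point of V(J) is a nonzerodivisor and lowers the
dimension, so the difference of h_J along the degree of s has no term in m^k. All Cartier α are
treated at once because splitting changes the twist. -/
theorem IsAmple.exists_isEvPoly {η : Φ.Cl} (hη : Φ.IsAmple η) {J : Ideal (MvPolynomial ι ℂ)}
    (hJ : Φ.IsHomog J) : ∀ k : ℕ, topologicalKrullDim (Φ.zeroLocus J) ≤ k →
      ∃ c, ∀ α, Φ.IsCartier α → IsEvPoly k c (fun m => (Φ.hilb J (m • η + α) : ℚ)) := by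
  refine devissage ?_ ?_ hJ
  · intro J hJ γ hγ s hs h1 h2 k hk
    obtain ⟨c₁, hc₁⟩ := h1 k ((topologicalKrullDim_mono (zeroLocus_colonElem_subset J s)).trans hk)
    obtain ⟨c₂, hc₂⟩ := h2 k ((topologicalKrullDim_mono (zeroLocus_sup_subset J _)).trans hk)
    refine ⟨c₁ + c₂, fun α hα => ((hc₁ (α - γ) (hα.sub hγ)).add (hc₂ α hα)).congr fun m => ?_⟩
    rw [hilb_eq_add' hJ hs, add_sub_assoc]
    push_cast
    rfl
  · intro J hJ hP ih k hk
    rcases (Φ.zeroLocus J).eq_empty_or_nonempty with hV | ⟨p, hp⟩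
    · refine ⟨0, fun α _ => IsEvPoly.of_eventually_zero ?_⟩
      filter_upwards [hη.eventually_hilb_eq_zero α hV] with m hm
      simp [hm]
    obtain ⟨x, rfl⟩ := exists_point_eq p
    have key : ∀ γ, Φ.IsCartier γ → ∀ s ∈ Φ.S γ, MvPolynomial.eval x.coord s ≠ 0 → ∀ α,
        Φ.IsCartier α →
        IsEvPoly k 0 (fun m => (Φ.hilb (J ⊔ Ideal.span {s}) (m • η + α) : ℚ)) := by
      intro γ hγ s hs hsx α hα
      cases k with
      | zero =>
        refine IsEvPoly.of_eventually_zero ?_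
        filter_upwards [hη.eventually_hilb_eq_zero α
          (hP.zeroLocus_eq_empty hJ hη hp hs hsx hk)] with m hm
        simp [hm]
      | succ k =>
        obtain ⟨c, hc⟩ := ih _ (lt_sup_span hJ hp hsx) (hJ.sup (isHomog_span_singleton hs)) k
          (hP.topologicalKrullDim_le hJ hη hp hs hsx hk)
        exact (hc α hα).succ
    have key' : ∀ (d : ℕ) (δ : Φ.Cl), Φ.IsCartier δ →
        (∃ s ∈ Φ.S (d • η + δ), MvPolynomial.eval x.coord s ≠ 0) → ∀ α, Φ.IsCartier α →
        IsEvPoly k 0 (fun m => (Φ.hilb J ((m + d) • η + (α + δ)) : ℚ) -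
          Φ.hilb J (m • η + α)) := by
      rintro d δ hδ ⟨s, hs, hsx⟩ α hα
      have hγ : Φ.IsCartier (d • η + δ) := (hη.1.nsmul d).add hδ
      refine ((key _ hγ s hs hsx (α + δ) (hα.add hδ)).comp_add d).congr fun m => ?_
      have := hP.hilb_add hJ hp hγ hs hsx (m • η + α)
      rw [show d • η + δ + (m • η + α) = (m + d) • η + (α + δ) by rw [add_smul]; abel] at this
      rw [this]
      push_cast
      ring
    have hex : ∀ α, Φ.IsCartier α → ∃ c, IsEvPoly k c (fun m => (Φ.hilb J (m • η + α) : ℚ)) := by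
      intro α hα
      have hev := hη.eventually_exists_eval_ne_zero Φ.isCartier_zero x
      -- Sections of two consecutive multiples of η give, by subtraction, the difference of h_J at
      -- step 1.
      obtain ⟨d, hd, hd'⟩ := (hev.and ((tendsto_add_atTop_nat 1).eventually hev)).exists
      have h1 := key' d 0 Φ.isCartier_zero hd α hα
      have h2 := key' (d + 1) 0 Φ.isCartier_zero hd' α hα
      simp only [add_zero] at h1 h2
      refine IsEvPoly.exists_of_diff' (IsEvPoly.of_comp_add d ?_)
      have h3 := h2.sub h1
      rw [sub_zero] at h3
      refine h3.congr fun m => ?_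
      rw [show m + d + 1 = m + (d + 1) by ring]
      ring
    choose! c hc using hex
    refine ⟨c 0, fun α hα => ?_⟩
    -- A section of dη + α compares the twist by α with the trivial twist, up to a shift of m by d.
    obtain ⟨d, hd⟩ := (hη.eventually_exists_eval_ne_zero hα x).exists
    have h1 := key' d α hα hd 0 Φ.isCartier_zero
    have h2 := ((hc α hα).comp_add d).sub (hc 0 Φ.isCartier_zero)
    simp only [zero_add] at h1
    have h3 := h1.unique h2
    rw [show c 0 = c α by linarith]
    exact hc α hα

theorem degree_eq {η : Φ.Cl} {Z : Set Φ.Variety} {k : ℕ} {c : ℚ}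
    (h : IsEvPoly k c (fun m => (Φ.hilb (Φ.ideal Z) (m • η) : ℚ))) :
    Φ.degree k η Z = k.factorial * c := by
  obtain ⟨P, -, hP, hev⟩ := h
  have hex : ∃ P : Polynomial ℚ, ∀ᶠ m : ℕ in atTop,
      P.eval (m : ℚ) = Φ.hilbertFunction Z (m • η) := ⟨P, hev.mono fun _ hm => hm.symm⟩
  have h1 : Φ.hilbertPoly η Z = P := by
    rw [hilbertPoly, dif_pos hex]
    refine Polynomial.eq_of_eventually_eval_eq ?_
    filter_upwards [hex.choose_spec, hev] with m h1 h2
    rw [h1, ← h2]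
    rfl
  rw [degree, h1, hP]

/-- The leading coefficient for zero-dimensional schemes is independent of the ample class. -/
theorem IsAmple.coeff_le_of_dim_zero {η γ : Φ.Cl} (hη : Φ.IsAmple η) (hγ : Φ.IsAmple γ)
    {J : Ideal (MvPolynomial ι ℂ)} (hJ : Φ.IsHomog J) :
    topologicalKrullDim (Φ.zeroLocus J) ≤ (0 : ℕ) → ∀ c c',
      IsEvPoly 0 c (fun m => (Φ.hilb J (m • γ + 0) : ℚ)) →
      IsEvPoly 0 c' (fun m => (Φ.hilb J (m • η + 0) : ℚ)) → c ≤ c' := by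
  refine devissage ?_ ?_ hJ
  · intro J hJ δ hδ s hs h1 h2 hk c c' hc hc'
    have hk1 := (topologicalKrullDim_mono (zeroLocus_colonElem_subset J s)).trans hk
    have hk2 := (topologicalKrullDim_mono (zeroLocus_sup_subset J (Ideal.span {s}))).trans hk
    have hJ1 := hJ.colonElem hs
    have hJ2 := hJ.sup (isHomog_span_singleton hs)
    obtain ⟨a, ha⟩ := hη.exists_isEvPoly hJ1 0 hk1
    obtain ⟨a', ha'⟩ := hγ.exists_isEvPoly hJ1 0 hk1
    obtain ⟨b, hb⟩ := hη.exists_isEvPoly hJ2 0 hk2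
    obtain ⟨b', hb'⟩ := hγ.exists_isEvPoly hJ2 0 hk2
    have e1 := h1 hk1 a' a (ha' 0 Φ.isCartier_zero) (ha 0 Φ.isCartier_zero)
    have e2 := h2 hk2 b' b (hb' 0 Φ.isCartier_zero) (hb 0 Φ.isCartier_zero)
    have e3 := hc.unique (((ha' (0 - δ) (Φ.isCartier_zero.sub hδ)).add
      (hb' 0 Φ.isCartier_zero)).congr fun m => by
        rw [hilb_eq_add' hJ hs, add_sub_assoc]; push_cast; rfl)
    have e4 := hc'.unique (((ha (0 - δ) (Φ.isCartier_zero.sub hδ)).add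
      (hb 0 Φ.isCartier_zero)).congr fun m => by
        rw [hilb_eq_add' hJ hs, add_sub_assoc]; push_cast; rfl)
    linarith
  · intro J hJ hP _ hk c c' hc hc'
    rcases (Φ.zeroLocus J).eq_empty_or_nonempty with hV | ⟨p, hp⟩
    · obtain ⟨m, h1, h2⟩ := (hc.eventually_eq.and (hγ.eventually_hilb_eq_zero 0 hV)).exists
      obtain ⟨m', h1', h2'⟩ := (hc'.eventually_eq.and (hη.eventually_hilb_eq_zero 0 hV)).exists
      rw [← h1, ← h1', h2, h2']
    obtain ⟨x, rfl⟩ := exists_point_eq p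
    obtain ⟨C, hC⟩ := hη.exists_isEvPoly hJ 0 hk
    have hCc := (hC 0 Φ.isCartier_zero).unique hc'
    subst hCc
    obtain ⟨m, hm⟩ := hc.eventually_eq.exists
    obtain ⟨a, ha, s, hs, hsx⟩ := ((eventually_ge_atTop 1).and
      (hη.eventually_exists_eval_ne_zero Φ.isCartier_zero x)).exists
    have hγ' : Φ.IsCartier (a • η + 0) := (hη.1.nsmul a).add Φ.isCartier_zero
    have hmono : ∀ j : ℕ, Φ.hilb J (m • γ + 0) ≤ Φ.hilb J ((a * j) • η + (m • γ + 0)) := by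
      intro j
      induction j with
      | zero => simp
      | succ j ih =>
        have := hP.hilb_add hJ hp hγ' hs hsx ((a * j) • η + (m • γ + 0))
        rw [show a • η + 0 + ((a * j) • η + (m • γ + 0)) = (a * (j + 1)) • η + (m • γ + 0) by
          rw [mul_add, add_smul, mul_one]; abel] at this
        omega
    have ht : Tendsto (fun j : ℕ => a * j) atTop atTop := tendsto_id.const_mul_atTop' ha
    obtain ⟨j, hj⟩ := (ht.eventually
      (hC _ ((hγ.1.nsmul m).add Φ.isCartier_zero)).eventually_eq).exists
    rw [← hm, ← hj]
    exact_mod_cast hmono j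

/-! ### Nefness -/

/-- This is the inequality β·η^k ≥ 0 on schemes of dimension at most k + 1. Cutting an irreducible
V(J) by a section of a multiple of η lowers k until V(J) is a curve, where the definition of nefness
applies. -/
theorem IsNef.coeff_nonneg {η β : Φ.Cl} (hη : Φ.IsAmple η) (hβ : Φ.IsNef β)
    {J : Ideal (MvPolynomial ι ℂ)} (hJ : Φ.IsHomog J) :
    ∀ k : ℕ, topologicalKrullDim (Φ.zeroLocus J) ≤ (k + 1 : ℕ) → ∀ α, Φ.IsCartier α → ∀ e,
      IsEvPoly k e (fun m => (Φ.hilb J (m • η + α) : ℚ) - Φ.hilb J (m • η + (α - β))) → 0 ≤ e := by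
  have hex : ∀ J, Φ.IsHomog J → ∀ k : ℕ, topologicalKrullDim (Φ.zeroLocus J) ≤ (k + 1 : ℕ) →
      ∀ α, Φ.IsCartier α → ∃ e, IsEvPoly k e
        (fun m => (Φ.hilb J (m • η + α) : ℚ) - Φ.hilb J (m • η + (α - β))) := by
    intro J hJ k hk α hα
    obtain ⟨c, hc⟩ := hη.exists_isEvPoly hJ (k + 1) hk
    have := (hc α hα).sub (hc (α - β) (hα.sub hβ.1))
    rw [sub_self] at this
    exact this.pred
  refine devissage ?_ ?_ hJ
  · intro J hJ γ hγ s hs h1 h2 k hk α hα e he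
    have hk1 := (topologicalKrullDim_mono (zeroLocus_colonElem_subset J s)).trans hk
    have hk2 := (topologicalKrullDim_mono (zeroLocus_sup_subset J (Ideal.span {s}))).trans hk
    obtain ⟨e₁, he₁⟩ := hex _ (hJ.colonElem hs) k hk1 (α - γ) (hα.sub hγ)
    obtain ⟨e₂, he₂⟩ := hex _ (hJ.sup (isHomog_span_singleton hs)) k hk2 α hα
    have h3 := he.unique ((he₁.add he₂).congr fun m => by
      rw [hilb_eq_add' hJ hs (m • η + α), hilb_eq_add' hJ hs (m • η + (α - β)),
        show m • η + α - γ = m • η + (α - γ) by abel,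
        show m • η + (α - β) - γ = m • η + (α - γ - β) by abel]
      push_cast
      ring)
    rw [h3]
    exact add_nonneg (h1 k hk1 _ (hα.sub hγ) e₁ he₁) (h2 k hk2 α hα e₂ he₂)
  · intro J hJ hP ih k hk α hα e he
    rcases (Φ.zeroLocus J).eq_empty_or_nonempty with hV | ⟨p, hp⟩
    · refine le_of_eq (he.unique (IsEvPoly.of_eventually_zero ?_)).symm
      filter_upwards [hη.eventually_hilb_eq_zero α hV,
        hη.eventually_hilb_eq_zero (α - β) hV] with m h1 h2
      simp [h1, h2]
    obtain ⟨x, rfl⟩ := exists_point_eq p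
    cases k with
    | succ k =>
      obtain ⟨d, hd, s, hs, hsx⟩ := ((eventually_ge_atTop 1).and
        (hη.eventually_exists_eval_ne_zero Φ.isCartier_zero x)).exists
      have hγ : Φ.IsCartier (d • η + 0) := (hη.1.nsmul d).add Φ.isCartier_zero
      have hadd : ∀ (m : ℕ) (δ : Φ.Cl), (Φ.hilb (J ⊔ Ideal.span {s}) ((m + d) • η + δ) : ℚ) =
          Φ.hilb J ((m + d) • η + δ) - Φ.hilb J (m • η + δ) := by
        intro m δ
        have := hP.hilb_add hJ hp hγ hs hsx (m • η + δ)
        rw [show d • η + 0 + (m • η + δ) = (m + d) • η + δ by rw [add_smul]; abel] at this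
        rw [this]
        push_cast
        ring
      have h1 : IsEvPoly k ((k + 1) * d * e) (fun m => (Φ.hilb (J ⊔ Ideal.span {s})
          (m • η + α) : ℚ) - Φ.hilb (J ⊔ Ideal.span {s}) (m • η + (α - β))) := by
        refine IsEvPoly.of_comp_add d ((he.diff d).congr fun m => ?_)
        rw [hadd, hadd]
        ring
      have h2 := ih _ (lt_sup_span hJ hp hsx) (hJ.sup (isHomog_span_singleton hs)) k
        (hP.topologicalKrullDim_le hJ hη hp hs hsx hk) α hα _ h1
      have h3 : (0 : ℚ) < (k + 1) * d := by positivity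
      exact nonneg_of_mul_nonneg_right h2 h3
    | zero =>
      by_cases hk0 : topologicalKrullDim (Φ.zeroLocus J) ≤ (0 : ℕ)
      · obtain ⟨c, hc⟩ := hη.exists_isEvPoly hJ 0 hk0
        have := he.unique ((hc α hα).sub (hc (α - β) (hα.sub hβ.1)))
        rw [this, sub_self]
      have hdim : topologicalKrullDim (Φ.zeroLocus J) = 1 := by
        refine le_antisymm (by simpa using hk) ?_
        generalize topologicalKrullDim (Φ.zeroLocus J) = t at hk0
        cases t with
        | bot => exact absurd bot_le hk0
        | coe t =>
          have h1 : t ≠ 0 := fun h => hk0 (by simp [h])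
          exact_mod_cast Order.one_le_iff_ne_zero.mpr h1
      have hirr : IsIrreducible (Φ.zeroLocus J) := ⟨⟨_, hp⟩, hP.isPreirreducible hJ hη⟩
      have hideal : ∀ δ, Φ.IsCartier δ →
          Φ.hilb (Φ.ideal (Φ.zeroLocus J)) δ = Φ.hilb J δ := fun δ hδ =>
        le_antisymm (hilb_anti (le_ideal_zeroLocus hJ) δ)
          (hilb_le_of_forall_mem fun g hg hgI => hP.mem_of_vanish hJ hη ⟨_, hp⟩ hδ hg hgI)
      -- With γ = dη + β, the finite scheme s = 0 on the curve C is measured by γ and by η: a = γ·C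
      -- and b = e + d(η·C). Independence of the ample class gives a ≤ b, and nefness gives γ·C ≥
      -- d(η·C), so e ≥ 0.
      obtain ⟨d, ⟨hd, hA⟩, hγ, s, hs, hsx⟩ := (((eventually_ge_atTop 1).and
        (hη.eventually_isAmple Φ.isCartier_zero)).and ((hη.eventually_isAmple hβ.1).and
        (hη.eventually_exists_eval_ne_zero hβ.1 x))).exists
      rw [add_zero] at hA
      obtain ⟨c₁, hc₁⟩ := hη.exists_isEvPoly hJ 1 (by simpa using hk)
      obtain ⟨cγ, hcγ⟩ := hγ.exists_isEvPoly hJ 1 (by simpa using hk)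
      have hnef := hβ.2 _ (isClosed_zeroLocus hJ) hirr hdim (d • η) hA (by rwa [add_comm])
      rw [add_comm β] at hnef
      have hdA : Φ.degree 1 (d • η) (Φ.zeroLocus J) = c₁ * d := by
        rw [degree_eq (k := 1) (c := c₁ * d ^ 1)]
        · simp
        · refine ((hc₁ 0 Φ.isCartier_zero).comp_mul hd).congr fun m => ?_
          rw [hideal _ ((hη.1.nsmul d).nsmul m), add_zero, smul_smul, mul_comm]
      have hdγ : Φ.degree 1 (d • η + β) (Φ.zeroLocus J) = cγ := by
        rw [degree_eq (k := 1) (c := cγ)]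
        · simp
        · refine (hcγ 0 Φ.isCartier_zero).congr fun m => ?_
          rw [hideal _ (hγ.1.nsmul m), add_zero]
      rw [hdA, hdγ] at hnef
      have hK := hJ.sup (isHomog_span_singleton hs)
      have hKd := hP.topologicalKrullDim_le hJ hη hp hs hsx hk
      obtain ⟨a, ha⟩ := hγ.exists_isEvPoly hK 0 hKd
      obtain ⟨b, hb⟩ := hη.exists_isEvPoly hK 0 hKd
      have hab := hη.coeff_le_of_dim_zero hγ hK hKd a b (ha 0 Φ.isCartier_zero)
        (hb 0 Φ.isCartier_zero)
      have hadd := hP.hilb_add hJ hp hγ.1 hs hsx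
      have h1 : a = cγ := by
        have h2 := ((hcγ 0 Φ.isCartier_zero).diff (n := 0) 1)
        have h3 := ((ha 0 Φ.isCartier_zero).comp_add 1).unique (h2.congr fun m => ?_)
        · simpa using h3
        · have := hadd (m • (d • η + β) + 0)
          rw [show d • η + β + (m • (d • η + β) + 0) = (m + 1) • (d • η + β) + 0 by
            rw [add_smul, one_smul]; abel] at this
          rw [this]
          push_cast
          ring
      have h2 : b = e + d * c₁ := by
        have h3 := (hc₁ (α - β) (hα.sub hβ.1)).diff (n := 0) d
        have h4 := ((hb α hα).comp_add d).unique (((he.comp_add d).add h3).congr fun m => ?_)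
        · simpa using h4
        · have := hadd (m • η + (α - β))
          rw [show d • η + β + (m • η + (α - β)) = (m + d) • η + α by
            rw [add_smul]; abel] at this
          rw [this]
          push_cast
          ring
      linarith

/-! ### Positivity of the leading coefficient -/

theorem ideal_anti {Z Y : Set Φ.Variety} (h : Z ⊆ Y) : Φ.ideal Y ≤ Φ.ideal Z := fun _ hg =>
  mem_ideal_iff.mpr fun x hx => mem_ideal_iff.mp hg x (h hx)

theorem colonElem_ideal_le {Z : Set Φ.Variety} (hZ : IsPreirreducible Z) {γ : Φ.Cl}
    {s : MvPolynomial ι ℂ} (hs : s ∈ Φ.S γ) (hsZ : s ∉ Φ.ideal Z) :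
    (Φ.ideal Z).colonElem s ≤ Φ.ideal Z := by
  intro g hg
  obtain ⟨T, hT⟩ := Φ.exists_eq_sum_comp g
  rw [hT]
  refine Ideal.sum_mem _ fun δ _ => ?_
  have h1 : s * Φ.comp δ g ∈ Φ.ideal Z := (isHomog_ideal Z).colonElem hs g hg δ
  have hmem : ∀ {α : Φ.Cl} {u : MvPolynomial ι ℂ}, u ∈ Φ.S α → ∀ {x : Φ.CoxSpace},
      Φ.point x ∈ Φ.zeroLocus (Ideal.span {u}) ↔ MvPolynomial.eval x.coord u = 0 := by
    intro α u hu x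
    rw [point_mem_zeroLocus_iff (isHomog_span_singleton hu)]
    refine ⟨fun h => h u (Ideal.mem_span_singleton_self u), fun h v hv => ?_⟩
    obtain ⟨w, rfl⟩ := Ideal.mem_span_singleton.mp hv
    rw [map_mul, h, zero_mul]
  have hsub : Z ⊆ Φ.zeroLocus (Ideal.span {s}) ∪ Φ.zeroLocus (Ideal.span {Φ.comp δ g}) := by
    intro p hp
    obtain ⟨x, rfl⟩ := exists_point_eq p
    have := mem_ideal_iff.mp h1 x hp
    rw [map_mul, mul_eq_zero] at this
    exact this.imp (hmem hs).mpr (hmem (comp_mem_S δ g)).mpr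
  rcases isPreirreducible_iff_isClosed_union_isClosed.mp hZ _ _
    (isClosed_zeroLocus (isHomog_span_singleton hs))
    (isClosed_zeroLocus (isHomog_span_singleton (comp_mem_S δ g))) hsub with h | h
  · exact absurd (mem_ideal_iff.mpr fun x hx => (hmem hs).mp (h hx)) hsZ
  · exact mem_ideal_iff.mpr fun x hx => (hmem (comp_mem_S δ g)).mp (h hx)

/-- Induction along a chain of maximal length. If Y is the predecessor of Z, a section of dη
vanishing on Y but not on Z is a nonzerodivisor modulo I(Z), so the difference of h_Z at step d
dominates h_Y. -/
theorem IsAmple.coeff_pos {η : Φ.Cl} (hη : Φ.IsAmple η) {j : ℕ} :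
    ∀ c : LTSeries (IrreducibleCloseds Φ.Variety), c.length = j →
      topologicalKrullDim (c.last : Set Φ.Variety) ≤ j →
      ∀ a, IsEvPoly j a (fun m => (Φ.hilb (Φ.ideal (c.last : Set Φ.Variety)) (m • η + 0) : ℚ)) →
        0 < a := by
  induction j with
  | zero =>
    intro c _ _ a ha
    obtain ⟨p, hp⟩ := c.last.isIrreducible.nonempty
    obtain ⟨x, rfl⟩ := exists_point_eq p
    obtain ⟨m, h1, s, hs, hsx⟩ := (ha.eventually_eq.and
      (hη.eventually_exists_eval_ne_zero Φ.isCartier_zero x)).exists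
    rw [← h1]
    have := one_le_hilb hs fun h => hsx (mem_ideal_iff.mp h x hp)
    exact_mod_cast this
  | succ j ih =>
    intro c hc hdim a ha
    set Z : Set Φ.Variety := (c.last : Set Φ.Variety) with hZ
    have hlt : c.eraseLast.last < c.last :=
      c.eraseLast_last_rel_last (by omega)
    set Y : Set Φ.Variety := (c.eraseLast.last : Set Φ.Variety) with hY
    have hYZ : Y ⊂ Z := hlt
    have hYc : IsClosed Y := c.eraseLast.last.isClosed
    have hYd := topologicalKrullDim_le_of_ssubset hYc c.last.isClosed c.last.isIrreducible hYZ hdim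
    obtain ⟨a', ha'⟩ := hη.exists_isEvPoly (isHomog_ideal Y) j (by rwa [hη.zeroLocus_ideal hYc])
    have hpos := ih c.eraseLast (by simp [hc]) hYd a' (ha' 0 Φ.isCartier_zero)
    obtain ⟨p, hpZ, hpY⟩ := Set.exists_of_ssubset hYZ
    obtain ⟨x, rfl⟩ := exists_point_eq p
    obtain ⟨d, hd, s, hs, hsx, hsY⟩ := hη.exists_section hYc hpY
    have hsZ : s ∉ Φ.ideal Z := fun h => hsx (mem_ideal_iff.mp h x hpZ)
    have hcol : (Φ.ideal Z).colonElem s = Φ.ideal Z :=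
      le_antisymm (colonElem_ideal_le c.last.isIrreducible.2 hs hsZ) (Ideal.le_colonElem _ _)
    have hle := ((ha' 0 Φ.isCartier_zero).comp_add d).le (ha.diff d)
      (Eventually.of_forall fun m => by
        have h1 := hilb_eq_add (isHomog_ideal Z) hs (m • η + 0)
        have h2 : Φ.hilb (Φ.ideal Y) (d • η + (m • η + 0)) ≤
            Φ.hilb (Φ.ideal Z ⊔ Ideal.span {s}) (d • η + (m • η + 0)) :=
          hilb_anti (sup_le (ideal_anti hYZ.1) ((Ideal.span_singleton_le_iff_mem _).mpr hsY)) _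
        rw [hcol] at h1
        rw [show d • η + (m • η + 0) = (m + d) • η + 0 by rw [add_smul]; abel] at h1 h2
        rw [h1]
        push_cast
        have h3 : (Φ.hilb (Φ.ideal Y) ((m + d) • η + 0) : ℚ) ≤
          Φ.hilb (Φ.ideal Z ⊔ Ideal.span {s}) ((m + d) • η + 0) := by exact_mod_cast h2
        linarith)
    have h4 : (0 : ℚ) < (j + 1) * d := by positivity
    exact (pos_iff_pos_of_mul_pos (lt_of_lt_of_le hpos hle)).mp h4

/-! ### Scheme-theoretic intersections -/

/-- `SameSubscheme` only tests degrees N·deg x̂_σ. Since η has a representative vanishing on σ, a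
monomial supported off σ moves g into such a degree; it divides a power of x̂_σ and is absorbed at
the end. -/
theorem IsSchemeInter.exists_xHat_pow_mul_mem {η : Φ.Cl} (hη : Φ.IsCartier η)
    {f : MvPolynomial ι ℂ} {W V : Set Φ.Variety} (h : Φ.IsSchemeInter f W V) {m : ℕ}
    {g : MvPolynomial ι ℂ} (hg : g ∈ Φ.S (m • η)) (hgV : g ∈ Φ.ideal V) {σ : Finset ι}
    (hσ : σ ∈ Φ.cones) : ∃ M, xHat σ ^ M * g ∈ Φ.ideal W ⊔ Ideal.span {f} := by
  obtain ⟨e, he, he0⟩ := hη.exists_cls_eq hσ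
  obtain ⟨N, hN⟩ : ∃ N : ℕ, ∀ ρ, (m : ℤ) * e ρ ≤ N := by
    refine ⟨∑ ρ, ((m : ℤ) * e ρ).toNat, fun ρ => ?_⟩
    have := Finset.single_le_sum (f := fun ρ => ((m : ℤ) * e ρ).toNat)
      (fun _ _ => Nat.zero_le _) (Finset.mem_univ ρ)
    exact (Int.self_le_toNat _).trans (by exact_mod_cast this)
  let c : ι →₀ ℕ := Finsupp.equivFunOnFinite.symm
    fun ρ => if ρ ∈ σ then 0 else ((N : ℤ) - m * e ρ).toNat
  have hc : (fun ρ => (c ρ : ℤ)) =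
      N • (fun ρ => ((∑ ρ ∈ σᶜ, Finsupp.single ρ 1 : ι →₀ ℕ) ρ : ℤ)) - m • e := by
    ext ρ
    by_cases hρ : ρ ∈ σ
    · simp [c, hρ, he0 ρ hρ, Finsupp.single_apply]
    · simp [c, hρ, Finsupp.single_apply, hN ρ]
  have hcdeg : Φ.mdeg c + m • η = N • Φ.degHat σ := by
    rw [mdeg, hc, cls_sub, cls_nsmul, cls_nsmul, he, ← Φ.mdeg_xHat σ]
    exact sub_add_cancel _ _
  have hmem : MvPolynomial.monomial c (1 : ℂ) * g ∈ Φ.S (N • Φ.degHat σ) :=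
    hcdeg ▸ mul_mem_S (monomial_mem_S c 1) hg
  obtain ⟨M, hM⟩ := (h σ hσ N _ hmem).mp ⟨0, Ideal.mul_mem_left _ _ (Ideal.mul_mem_left _ _ hgV)⟩
  have hdvd : MvPolynomial.monomial c (1 : ℂ) ∣ xHat σ ^ (∑ ρ, c ρ) := by
    rw [xHat_eq_monomial, MvPolynomial.monomial_pow, one_pow]
    refine MvPolynomial.monomial_dvd_monomial.mpr ⟨Or.inr fun ρ => ?_, one_dvd _⟩
    by_cases hρ : ρ ∈ σ
    · simp [c, hρ]
    · simpa [Finsupp.single_apply, hρ] using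
        Finset.single_le_sum (f := fun ρ => c ρ) (fun _ _ => Nat.zero_le _) (Finset.mem_univ ρ)
  obtain ⟨r, hr⟩ := hdvd
  refine ⟨M + ∑ ρ, c ρ, ?_⟩
  rw [pow_add, hr, show xHat σ ^ M * (MvPolynomial.monomial c 1 * r) * g =
    r * (xHat σ ^ M * (MvPolynomial.monomial c 1 * g)) by ring]
  exact Ideal.mul_mem_left _ _ hM

/-- The parts of J in degrees mη generate an ideal with finitely many homogeneous generators. In
large complementary degree everything multiplies each of them into J', by
`IsAmple.eventually_mul_mem`. -/
theorem IsAmple.eventually_mem_of_xHat_pow_mul_mem {η : Φ.Cl} (hη : Φ.IsAmple η)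
    {J J' : Ideal (MvPolynomial ι ℂ)}
    (h : ∀ (m : ℕ), ∀ g ∈ Φ.S (m • η), g ∈ J → ∀ σ ∈ Φ.cones, ∃ M, xHat σ ^ M * g ∈ J') :
    ∀ᶠ m : ℕ in atTop, ∀ g ∈ Φ.S (m • η), g ∈ J → g ∈ J' := by
  have hfg : (Submodule.span (MvPolynomial ι ℂ)
      {g | ∃ m : ℕ, g ∈ Φ.S (m • η) ∧ g ∈ J}).FG := IsNoetherian.noetherian _
  obtain ⟨T, hT, hspan⟩ := (Submodule.fg_span_iff_fg_span_finset_subset _).mp hfg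
  have h1 : ∀ t : T, ∀ᶠ m : ℕ in atTop, ∃ δ, (∃ k : ℕ, (t : MvPolynomial ι ℂ) ∈ Φ.S (k • η) ∧
      k • η + δ = m • η) ∧ ∀ u ∈ Φ.S δ, u * (t : MvPolynomial ι ℂ) ∈ J' := by
    intro t
    obtain ⟨k, hk, hkJ⟩ := hT t.2
    filter_upwards [hη.eventually_mul_mem (-(k • η)) (h k t hk hkJ)] with m hm
    exact ⟨_, ⟨k, hk, by abel⟩, hm⟩
  filter_upwards [eventually_all.mpr h1] with m hm g hg hgJ
  have hgs : g ∈ Submodule.span (MvPolynomial ι ℂ) (T : Set (MvPolynomial ι ℂ)) := by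
    rw [← hspan]
    exact Submodule.subset_span ⟨m, hg, hgJ⟩
  obtain ⟨u, -, hu⟩ := Submodule.mem_span_finset.mp hgs
  rw [← comp_of_mem hg, ← hu, map_sum]
  refine J'.sum_mem fun t ht => ?_
  obtain ⟨δ, ⟨k, hk, hkδ⟩, hδ⟩ := hm ⟨t, ht⟩
  rw [smul_eq_mul, mul_comm, ← hkδ, comp_mul hk, mul_comm]
  exact hδ _ (comp_mem_S δ _)

/-- The kernel of A → ℚ ⊗ A is torsion, so N and p carry a factor killing the torsion besides the
denominator and numerator of q. -/
theorem exists_nsmul_eq_of_tmul_eq {A : Type*} [AddCommGroup A] {a b c : A} {q : ℚ} (hq : 0 < q)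
    (h : (1 : ℚ) ⊗ₜ[ℤ] a = q ⊗ₜ[ℤ] b + (1 : ℚ) ⊗ₜ[ℤ] c) :
    ∃ N p : ℕ, 1 ≤ N ∧ q = p / N ∧ N • a = p • b + N • c := by
  have hnum : ((q.num.toNat : ℕ) : ℤ) = q.num := Int.toNat_of_nonneg (Rat.num_pos.mpr hq).le
  have hx : TensorProduct.mk ℤ ℚ A 1 ((q.den : ℤ) • a - (q.num • b + (q.den : ℤ) • c)) = 0 := by
    rw [map_sub, map_add, map_smul, map_smul, map_smul]
    simp only [TensorProduct.mk_apply]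
    have hz : ∀ (k : ℤ) (x : ℚ), k • (x ⊗ₜ[ℤ] b) = (k • x) ⊗ₜ[ℤ] b := fun k x =>
      (map_zsmul ((TensorProduct.mk ℤ ℚ A).flip b) k x).symm
    rw [h, smul_add, add_sub_add_right_eq_sub, hz, hz, ← TensorProduct.sub_tmul]
    have : ((q.den : ℤ) • q - q.num • (1 : ℚ)) = 0 := by
      rw [zsmul_eq_mul, zsmul_eq_mul, mul_one, sub_eq_zero]
      push_cast
      exact Rat.den_mul_eq_num q
    rw [this, TensorProduct.zero_tmul]
  obtain ⟨⟨r, hr⟩, hr0⟩ := (IsLocalizedModule.eq_zero_iff (nonZeroDivisors ℤ)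
    (TensorProduct.mk ℤ ℚ A 1)).mp hx
  have hr' : r ≠ 0 := nonZeroDivisors.ne_zero hr
  have hr1 : (r.natAbs : ℤ) • ((q.den : ℤ) • a - (q.num • b + (q.den : ℤ) • c)) = 0 := by
    have h0 : r • ((q.den : ℤ) • a - (q.num • b + (q.den : ℤ) • c)) = 0 := hr0
    rcases Int.natAbs_eq r with h1 | h1
    · rw [← h1, h0]
    · rw [show (r.natAbs : ℤ) = -r by omega, neg_smul, h0, neg_zero]
  refine ⟨r.natAbs * q.den, r.natAbs * q.num.toNat, ?_, ?_, ?_⟩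
  · exact Nat.mul_pos (Int.natAbs_pos.mpr hr') q.den_pos
  · have h1 : (r.natAbs : ℚ) ≠ 0 := by simpa using hr'
    have h2 : ((q.num.toNat : ℕ) : ℚ) = (q.num : ℚ) := by exact_mod_cast congrArg (Int.cast (R := ℚ)) hnum
    push_cast [h2]
    rw [mul_div_mul_left _ _ (by exact_mod_cast h1), Rat.num_div_den]
  · rw [smul_sub, sub_eq_zero, smul_add, smul_smul, smul_smul, smul_smul, ← hnum] at hr1
    exact_mod_cast hr1

theorem ideal_mem_of_sq_mem {Z : Set Φ.Variety} {g : MvPolynomial ι ℂ} (h : g * g ∈ Φ.ideal Z) :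
    g ∈ Φ.ideal Z :=
  mem_ideal_iff.mpr fun x hx => mul_self_eq_zero.mp (by simpa using mem_ideal_iff.mp h x hx)

theorem IsAmple.zeroLocus_subset_of_isSchemeInter {η : Φ.Cl} (hη : Φ.IsAmple η)
    {f : MvPolynomial ι ℂ} {W V : Set Φ.Variety} (hV : IsClosed V) (h : Φ.IsSchemeInter f W V) :
    Φ.zeroLocus (Φ.ideal W ⊔ Ideal.span {f}) ⊆ V := by
  rintro _ ⟨x, hx, rfl⟩
  by_contra hxV
  obtain ⟨d, -, s, hs, hsx, hsV⟩ := hη.exists_section hV hxV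
  obtain ⟨σ, hσ, hxσ⟩ := x.mem
  obtain ⟨M, hM⟩ := h.exists_xHat_pow_mul_mem hη.1 hs hsV hσ
  have := hx _ hM
  rw [map_mul, map_pow] at this
  exact mul_ne_zero (pow_ne_zero _ (eval_xHat_ne_zero_iff.mpr hxσ)) hsx this

/-- For a hypersurface `f = 0` that contains no component of `V(J)`, the growth rate of the
Hilbert function in the direction of `β = [f]` compares with that in the direction of `η`. -/
theorem le_coeff_of_nsmul_eq {η β β' : Φ.Cl} (hη : Φ.IsAmple η) (hβ : Φ.IsCartier β)
    (hβ' : Φ.IsNef β') {N p : ℕ} (hNp : N • β = p • η + N • β') {J : Ideal (MvPolynomial ι ℂ)}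
    (hJ : Φ.IsHomog J) {f : MvPolynomial ι ℂ} (hf : f ∈ Φ.S β) (hfJ : J.colonElem f ≤ J) {k : ℕ}
    (hdim : topologicalKrullDim (Φ.zeroLocus J) ≤ (k + 1 : ℕ)) {c e : ℚ}
    (hc : ∀ α, Φ.IsCartier α → IsEvPoly (k + 1) c (fun m => (Φ.hilb J (m • η + α) : ℚ)))
    (he : ∀ α, Φ.IsCartier α →
      IsEvPoly k e (fun m => (Φ.hilb (J ⊔ Ideal.span {f}) (m • η + α) : ℚ))) :
    (k + 1) * p * c ≤ N * e := by
  have hstep : ∀ α, Φ.IsCartier α → IsEvPoly k e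
      (fun m => (Φ.hilb J (m • η + α) : ℚ) - Φ.hilb J (m • η + (α - β))) := by
    intro α hα
    refine (he α hα).congr fun m => ?_
    have := hilb_eq_add' hJ hf (m • η + α)
    rw [le_antisymm hfJ (J.le_colonElem f), add_sub_assoc] at this
    rw [this]
    push_cast
    ring
  have hβN : ∀ j : ℕ, IsEvPoly k (j * e)
      (fun m => (Φ.hilb J (m • η + 0) : ℚ) - Φ.hilb J (m • η + (0 - j • β))) := by
    intro j
    induction j with
    | zero =>
      rw [Nat.cast_zero, zero_mul]
      exact IsEvPoly.of_eventually_zero (by simp)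
    | succ j ih =>
      have := ih.add (hstep (0 - j • β) (Φ.isCartier_zero.sub (hβ.nsmul j)))
      rw [show ((j + 1 : ℕ) : ℚ) * e = j * e + e by push_cast; ring]
      refine this.congr fun m => ?_
      rw [show 0 - (j + 1) • β = 0 - j • β - β by rw [add_smul, one_smul]; abel]
      ring
  have hβ'N : ∀ j : ℕ, ∃ a, 0 ≤ a ∧ IsEvPoly k a
      (fun m => (Φ.hilb J (m • η + 0) : ℚ) - Φ.hilb J (m • η + (0 - j • β'))) := by
    intro j
    induction j with
    | zero => exact ⟨0, le_rfl, IsEvPoly.of_eventually_zero (by simp)⟩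
    | succ j ih =>
      obtain ⟨a, ha0, ha⟩ := ih
      have hα : Φ.IsCartier (0 - j • β') := Φ.isCartier_zero.sub (hβ'.1.nsmul j)
      have h1 := (hc _ hα).sub (hc _ (hα.sub hβ'.1))
      rw [sub_self] at h1
      obtain ⟨b, hb⟩ := h1.pred
      refine ⟨a + b, add_nonneg ha0 (hβ'.coeff_nonneg hη hJ k hdim _ hα b hb),
        (ha.add hb).congr fun m => ?_⟩
      rw [show 0 - (j + 1) • β' = 0 - j • β' - β' by rw [add_smul, one_smul]; abel]
      ring
  obtain ⟨a, ha0, ha⟩ := hβ'N N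
  -- As Nβ − Nβ' = pη, the rest of the descent is a shift of m by p.
  have hp : IsEvPoly k ((k + 1) * p * c) (fun m => (Φ.hilb J (m • η + (0 - N • β')) : ℚ) -
      Φ.hilb J (m • η + (0 - N • β))) := by
    refine IsEvPoly.of_comp_add p
      (((hc _ (Φ.isCartier_zero.sub (hβ'.1.nsmul N))).diff p).congr fun m => ?_)
    rw [hNp, show (m + p) • η + (0 - (p • η + N • β')) = m • η + (0 - N • β') by
      rw [add_smul]; abel]
  have := (hβN N).unique ((ha.add hp).congr fun m => by ring)
  linarith

theorem le_degree_of_isSchemeInter {η β β' : Φ.Cl} {q : ℚ} (hq : 0 < q) (hη : Φ.IsAmple η)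
    (hβ : Φ.IsCartier β) (hβ' : Φ.IsNef β')
    (hsum : (1 : ℚ) ⊗ₜ[ℤ] β = q ⊗ₜ[ℤ] η + (1 : ℚ) ⊗ₜ[ℤ] β') {f : MvPolynomial ι ℂ}
    (hf : f ∈ Φ.S β) {k : ℕ} {V W : Set Φ.Variety} (hV : IsClosed V)
    (hVdim : topologicalKrullDim V = (k : ℕ)) (hW : IsClosed W)
    (hWdim : topologicalKrullDim W = (k + 1 : ℕ)) (h : Φ.IsSchemeInter f W V) :
    q ≤ Φ.degree k η V := by
  obtain ⟨N, p, hN, hqNp, hNp⟩ := exists_nsmul_eq_of_tmul_eq hq hsum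
  set J := Φ.ideal W
  set K := J.colonElem f with hKdef
  have hJ : Φ.IsHomog J := isHomog_ideal W
  have hK : Φ.IsHomog K := hJ.colonElem hf
  -- From f²g ∈ I(W) follows (fg)² ∈ I(W), and I(W) is radical.
  have hKf : K.colonElem f ≤ K := by
    intro g hg
    have h1 : f * (f * g) ∈ J := hg
    have h2 : f * g * (f * g) ∈ Φ.ideal W := by
      rw [show f * g * (f * g) = g * (f * (f * g)) by ring]
      exact J.mul_mem_left g h1
    exact ideal_mem_of_sq_mem h2
  have hKW : Φ.zeroLocus K ⊆ W := by
    rw [← hη.zeroLocus_ideal hW]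
    exact zeroLocus_colonElem_subset _ _
  have hKdim : topologicalKrullDim (Φ.zeroLocus K) ≤ (k + 1 : ℕ) :=
    hWdim ▸ topologicalKrullDim_mono hKW
  have hJV := hη.zeroLocus_subset_of_isSchemeInter hV h
  have hKV : Φ.zeroLocus (K ⊔ Ideal.span {f}) ⊆ V :=
    (zeroLocus_anti (sup_le_sup_right (J.le_colonElem f) _)).trans hJV
  obtain ⟨c, hc⟩ := hη.exists_isEvPoly hK (k + 1) hKdim
  obtain ⟨e, he⟩ := hη.exists_isEvPoly (hK.sup (isHomog_span_singleton hf)) k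
    (hVdim ▸ topologicalKrullDim_mono hKV)
  obtain ⟨v, hv⟩ := hη.exists_isEvPoly (isHomog_ideal V) k
    (by rw [hη.zeroLocus_ideal hV]; exact hVdim.le)
  have hev : e ≤ v := by
    refine (he 0 Φ.isCartier_zero).le (hv 0 Φ.isCartier_zero) ?_
    filter_upwards [hη.eventually_mem_of_xHat_pow_mul_mem fun m g hg hgV σ hσ =>
      h.exists_xHat_pow_mul_mem hη.1 hg hgV hσ] with m hm
    rw [add_zero]
    have h1 : Φ.hilb (J ⊔ Ideal.span {f}) (m • η) ≤ Φ.hilb (Φ.ideal V) (m • η) :=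
      hilb_le_of_forall_mem hm
    have h2 := hilb_eq_add' hJ hf (m • η)
    have h3 := hilb_eq_add' hK hf (m • η)
    rw [le_antisymm hKf (K.le_colonElem f)] at h3
    have h4 := hilb_anti (J.le_colonElem f) (m • η)
    rw [← hKdef] at h2 h4
    have h5 : Φ.hilb (K ⊔ Ideal.span {f}) (m • η) ≤ Φ.hilb (Φ.ideal V) (m • η) := by omega
    exact_mod_cast h5
  have hcpos : 0 < c := by
    have hKd : ¬ topologicalKrullDim (Φ.zeroLocus K) ≤ k := by
      intro hlt
      -- Where f does not vanish, W lies in V(K); where it does, W lies in V. As dim V = k, the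
      -- locus V(K) must have dimension k + 1.
      have hsub : W ⊆ Φ.zeroLocus K ∪ V := by
        intro x hx
        obtain ⟨x, rfl⟩ := exists_point_eq x
        by_cases hfx : MvPolynomial.eval x.coord f = 0
        · refine Or.inr (hJV ((point_mem_zeroLocus_sup_span_iff hJ hf).mpr ⟨?_, hfx⟩))
          rwa [hη.zeroLocus_ideal hW]
        · refine Or.inl ((point_mem_zeroLocus_iff hK).mpr fun g hg => ?_)
          have := mem_ideal_iff.mp (show f * g ∈ Φ.ideal W from hg) x hx
          rw [map_mul] at this
          exact (mul_eq_zero.mp this).resolve_left hfx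
      have h1 := (topologicalKrullDim_mono hsub).trans
        (topologicalKrullDim_union_le (isClosed_zeroLocus hK) hV hlt hVdim.le)
      rw [hWdim] at h1
      have h2 : k + 1 ≤ k := by exact_mod_cast h1
      omega
    rw [topologicalKrullDim_le_iff_length_le (isClosed_zeroLocus hK)] at hKd
    push Not at hKd
    obtain ⟨s, hs, hks⟩ := hKd
    have hlen : s.length = k + 1 := le_antisymm
      ((topologicalKrullDim_le_iff_length_le (isClosed_zeroLocus hK) _).mp hKdim s hs) hks
    have hsdim := (topologicalKrullDim_mono hs).trans hKdim
    -- The top of a chain of length k + 1 in V(K) has positive leading coefficient, and its Hilbert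
    -- function is at most that of K.
    obtain ⟨a, ha⟩ := hη.exists_isEvPoly (isHomog_ideal (s.last : Set Φ.Variety)) (k + 1)
      (by rwa [hη.zeroLocus_ideal s.last.isClosed])
    refine (hη.coeff_pos s hlen hsdim a (ha 0 Φ.isCartier_zero)).trans_le
      ((ha 0 Φ.isCartier_zero).le (hc 0 Φ.isCartier_zero) (Eventually.of_forall fun m => ?_))
    exact_mod_cast hilb_anti ((le_ideal_zeroLocus hK).trans (ideal_anti hs)) _
  have hcint : 1 ≤ ((k + 1).factorial : ℚ) * c := by
    obtain ⟨a, ha⟩ := IsEvPoly.exists_int (fun m => (Φ.hilb K (m • η + 0) : ℤ))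
      ((hc 0 Φ.isCartier_zero).congr fun m => by simp)
    have h1 : (0 : ℚ) < a := by
      rw [← ha]
      positivity
    rw [ha]
    exact_mod_cast (show (0 : ℤ) < a by exact_mod_cast h1)
  have hle := le_coeff_of_nsmul_eq hη hβ hβ' hNp hK hf hKf hKdim hc he
  have hN0 : (0 : ℚ) < N := by exact_mod_cast hN
  have hqe : (k + 1) * q * c ≤ e := by
    rw [hqNp]
    have : (k + 1) * (p / N : ℚ) * c = (k + 1) * p * c / N := by ring
    rw [this, div_le_iff₀ hN0]
    linarith
  rw [degree_eq ((hv 0 Φ.isCartier_zero).congr fun m => by rw [add_zero])]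
  calc q ≤ q * (((k + 1).factorial : ℚ) * c) := le_mul_of_one_le_right hq.le hcint
    _ = k.factorial * ((k + 1) * q * c) := by
      rw [Nat.factorial_succ]
      push_cast
      ring
    _ ≤ k.factorial * v := mul_le_mul_of_nonneg_left (hqe.trans hev) (by positivity)

end SimplicialFan

theorem mainTheorem4 {k : ℕ} {ι : Type*} [Fintype ι] [DecidableEq ι]
    (Φ : SimplicialFan (2 * k + 1) ι)
    (η β β' : Φ.Cl) (q : ℚ) (hq : 0 < q)
    (hη : Φ.IsAmple η) (hβ : Φ.IsAmple β) (hβ' : Φ.IsNef β')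
    (hsum : (1 : ℚ) ⊗ₜ[ℤ] β = q ⊗ₜ[ℤ] η + (1 : ℚ) ⊗ₜ[ℤ] β')
    (f : MvPolynomial ι ℂ) (hf : f ∈ Φ.S β) (hf0 : f ≠ 0)
    (V : Set Φ.Variety) (hV : IsClosed V) (hVdim : topologicalKrullDim V = (k : ℕ))
    (hVX : ∃ W : Set Φ.Variety, IsClosed W ∧ topologicalKrullDim W = (k + 1 : ℕ) ∧
      Φ.IsSchemeInter f W V) :
    q ≤ Φ.degree k η V := by
  obtain ⟨W, hW, hWdim, h⟩ := hVX
  exact SimplicialFan.le_degree_of_isSchemeInter hq hη hβ.1 hβ' hsum hf hV hVdim hW hWdim h
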